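/- **Setting.** The state is $\omega\in\{0,1\}$ and there are $n\ge 1$ experts. A signal structure $\theta$ is a joint distribution of the state and of private signals $S_1,\dots,S_n$ in some signal space (the prior $\Pr[\omega=1]\in[0,1]$ is part of $\theta$); it is *c.i.i.d.* if, conditionally on each state of positive probability, the signals are independent and identically distributed. For a rationality level $\lambda\ge 0$ let $$\psi_\lambda(p)=\frac1{1+e^{2\lambda(1-2p)}}\quad(p\in[0,1]),\qquad \psi_\infty(p)=\begin{cases}1,&p>1/2\\1/2,&p=1/2\\0,&p<1/2.\end{cases}$$ Given the state and the signals, the experts report independently, expert $i$ reporting $X_i=1$ with probability $\psi(\Pr[\omega=1\mid S_i])$ and $X_i=0$ otherwise. The resulting joint distribution of $(\omega,X_1,\dots,X_n)$ is the report structure $\mathrm{rep}(\theta,\psi)$, and $\hat\Theta^{ciid}_\lambda$ is the set of all $\mathrm{rep}(\theta,\psi_\lambda)$ with $\theta$ c.i.i.d. An aggregator is a function $f:\{0,\dots,n\}\to[0,1]$; with $X=\sum_i X_i$ its utility under a report structure $\hat\theta$ is $$U(f,\hat\theta)=\sum_{x=0}^n\Pr_{\hat\theta}[X=x]\,\bigl(2\Pr_{\hat\theta}[\omega=1\mid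 X=x]-1\bigr)\bigl(2f(x)-1\bigr).$$ The omniscient aggregator $\mathrm{opt}_{\hat\theta}(x)$ is $1$, $1/2$ or $0$ according as $\Pr_{\hat\theta}[\omega=1\mid X=x]$ is greater than, equal to or less than $1/2$, and the regret is $R(f,\hat\theta)=U(\mathrm{opt}_{\hat\theta},\hat\theta)-U(f,\hat\theta)$. Majority voting $f^{maj}$ is $f^{maj}(x)=0$ for $x<n/2$, $1/2$ for $x=n/2$, and $1$ for $x>n/2$. Let $g(n)\in[0,\infty]$ be the supremum of the set of all real $\lambda\ge0$ such that for all $q_0,q_1$ with $\psi_\lambda(0)<q_0\le q_1\le\frac12$, $$\frac{(q_1(1-q_1))^{\lfloor\frac{n-1}2\rfloor}(1-2q_1)}{\psi_\lambda(1)-q_1}\le\frac{(q_0(1-q_0))^{\lfloor\frac{n-1}2\rfloor}(1-2q_0)}{\psi_\lambda(1)-q_0}\cdot\frac{2\lambda+\ln(1-q_0)-\ln q_0}{2\lambda-\ln(1-q_0)+\ln q_0}.$$ **Theorem.** 1. *(Optimal robust aggregator.)* Let $n\ge1$ and let $0\le\lambda<\infty$ with $\lambda\le g(n)$. Then $$\max_{\hat\theta\in\hat\Theta^{ciid}_\lambda}R(f^{maj},\hat\theta)=\min_f\max_{\hat\theta\in\hat\Theta^{ciid}_\lambda}R(f,\hat\theta),$$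 where all the maxima and the minimum are attained. Moreover $g(n)=\infty$ for $n\le2$. 2. *(Bounded rationality advantage.)* For $n=1$, perfect rationality is best: for every c.i.i.d. $\theta$ and every $\lambda\ge0$, $$\max_fU(f,\mathrm{rep}(\theta,\psi_\lambda))\le U(f^{maj},\mathrm{rep}(\theta,\psi_\infty))=\max_fU(f,\mathrm{rep}(\theta,\psi_\infty)).$$ But for every $n\ge2$ there are a c.i.i.d. signal structure $\theta^*$ and a finite $\lambda^*\ge0$ with $$\max_fU(f,\mathrm{rep}(\theta^*,\psi_{\lambda^*}))>\max_fU(f,\mathrm{rep}(\theta^*,\psi_\infty)),$$ and, if $n>2$, for the same $\theta^*$ and $\lambda^*$ also $$U(f^{maj},\mathrm{rep}(\theta^*,\psi_{\lambda^*}))>\max_fU(f,\mathrm{rep}(\theta^*,\psi_\infty)).$$ -/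

import Mathlib

open MeasureTheory ProbabilityTheory Set

noncomputable section

namespace QuantalVoting

/-! ### Signal structures

The state space `{0, 1}` is `Bool`, with `true` for the state `1`; a binary decision is also an
element of `Bool`, with `true` for the decision `1`. -/

/-- A signal structure with `n` experts: a set of signals (with its measurable sets) and a joint
distribution of the state and of the `n` private signals. -/
structure SignalStructure (n : ℕ) where
  Signal : Type
  [measurableSpaceSignal : MeasurableSpace Signal]
  law : Measure (Bool × (Fin n → Signal))
  [isProbabilityMeasure_law : IsProbabilityMeasure law]

attribute [instance] SignalStructure.measurableSpaceSignal
attribute [instance] SignalStructure.isProbabilityMeasure_law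

namespace SignalStructure

variable {n : ℕ}

/-- Conditionally on each state of positive probability, the signals are independent and
identically distributed. -/
def IsCIID (θ : SignalStructure n) : Prop :=
  ∀ w : Bool, θ.law (Prod.fst ⁻¹' {w}) ≠ 0 →
    ∃ κ : ProbabilityMeasure θ.Signal,
      (cond θ.law (Prod.fst ⁻¹' {w})).map Prod.snd
        = Measure.pi (fun _ : Fin n => (κ : Measure θ.Signal))

/-- The posterior belief `Pr[ω = 1 | S_i = s]` of expert `i`. -/
def posterior (θ : SignalStructure n) (i : Fin n) (s : θ.Signal) : ℝ :=
  (condDistrib (Prod.fst : Bool × (Fin n → θ.Signal) → Bool) (fun z => z.2 i) θ.law s).real {true}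

end SignalStructure

/-! ### Quantal response -/

/-- The quantal response function `φ_λ`: the probability of the decision `1` as a function of the
expected utility of that decision. -/
def quantalResponse (lam v : ℝ) : ℝ := 1 / (1 + Real.exp (-2 * lam * v))

/-- `ψ_λ`: the probability of the decision `1` as a function of the posterior `p` of the state
`1`; the expected utility of the decision `1` is `2 * p - 1`. -/
def psi (lam p : ℝ) : ℝ := quantalResponse lam (2 * p - 1)

/-- `ψ_∞`: the response of a perfectly rational expert. -/
def psiInfty (p : ℝ) : ℝ := if 1 / 2 < p then 1 else if p = 1 / 2 then 1 / 2 else 0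

/-! ### Report structures -/

/-- Joint probability masses of the state and of the `n` reports. -/
abbrev ReportStructure (n : ℕ) : Type := Bool × (Fin n → Bool) → ℝ

/-- The report structure induced by the signal structure `θ` and the response function `ψ`: given
the state and the signals, expert `i` reports `1` with probability `ψ (Pr[ω = 1 | S_i])`,
independently of the other experts. -/
def rep {n : ℕ} (θ : SignalStructure n) (ψ : ℝ → ℝ) : ReportStructure n := fun wr =>
  ∫ z in Prod.fst ⁻¹' {wr.1},
    ∏ i, (if wr.2 i then ψ (θ.posterior i (z.2 i)) else 1 - ψ (θ.posterior i (z.2 i))) ∂θ.law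

/-- The report structures induced by all c.i.i.d. signal structures with `n` experts. -/
def ciidReports (n : ℕ) (ψ : ℝ → ℝ) : Set (ReportStructure n) :=
  {r | ∃ θ : SignalStructure n, θ.IsCIID ∧ rep θ ψ = r}

/-- The number of experts who report `1`. -/
def votes {n : ℕ} (x : Fin n → Bool) : ℕ := (Finset.univ.filter fun i => x i = true).card

/-- `Pr[ω = w, X = x]`, where `X` is the number of experts who report `1`. -/
def prStateVotes {n : ℕ} (r : ReportStructure n) (w : Bool) (x : ℕ) : ℝ :=
  ∑ y ∈ Finset.univ.filter (fun y : Fin n → Bool => votes y = x), r (w, y)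

/-- `Pr[X = x]`. -/
def prVotes {n : ℕ} (r : ReportStructure n) (x : ℕ) : ℝ :=
  prStateVotes r false x + prStateVotes r true x

/-- `Pr[ω = 1 | X = x]`. It is only used where `Pr[X = x] ≠ 0`, or multiplied by `Pr[X = x]`. -/
def prTrueGivenVotes {n : ℕ} (r : ReportStructure n) (x : ℕ) : ℝ :=
  prStateVotes r true x / prVotes r x

/-! ### Aggregators -/

/-- An aggregator: the probability of guessing the state `1` given the number of reports `1`. -/
abbrev Aggregator (n : ℕ) : Type := Fin (n + 1) → unitInterval

/-- The mixed decision that guesses each state with probability `1/2`. -/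
def fair : unitInterval := ⟨1 / 2, by norm_num, by norm_num⟩

/-- The utility of the aggregator `f`. -/
def utility {n : ℕ} (f : Aggregator n) (r : ReportStructure n) : ℝ :=
  ∑ x : Fin (n + 1), prVotes r x * (2 * prTrueGivenVotes r x - 1) * (2 * (f x : ℝ) - 1)

/-- The omniscient aggregator. -/
def omniscient {n : ℕ} (r : ReportStructure n) : Aggregator n := fun x =>
  if 1 / 2 < prTrueGivenVotes r x then 1
  else if prTrueGivenVotes r x = 1 / 2 then fair
  else 0

/-- Majority voting. -/
def majority (n : ℕ) : Aggregator n := fun x =>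
  if 2 * (x : ℕ) < n then 0 else if 2 * (x : ℕ) = n then fair else 1

/-- The regret of `f` with respect to the omniscient aggregator. -/
def regret {n : ℕ} (f : Aggregator n) (r : ReportStructure n) : ℝ :=
  utility (omniscient r) r - utility f r

/-- The worst-case regret of `f` over all report structures that c.i.i.d. signal structures induce
through `ψ`. -/
def worstRegret (n : ℕ) (ψ : ℝ → ℝ) (f : Aggregator n) : ℝ :=
  sSup (regret f '' ciidReports n ψ)

/-- The optimal utility `max_f U(f, r)`. -/
def maxUtility {n : ℕ} (r : ReportStructure n) : ℝ :=
  sSup (range fun f : Aggregator n => utility f r)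

/-- The supremum that defines the optimal utility is attained. -/
theorem isGreatest_maxUtility {n : ℕ} (r : ReportStructure n) :
    IsGreatest (range fun f : Aggregator n => utility f r) (maxUtility r) := by
  have hc : Continuous fun f : Aggregator n => utility f r := by
    unfold utility
    fun_prop
  exact (isCompact_range hc).isGreatest_sSup (range_nonempty _)

/-! ### The threshold -/

/-- The rationality levels `λ ≥ 0` that satisfy the inequality for all `q₀, q₁`. At
`q₀ = ψ_λ(0)` the last denominator vanishes, so this end of the range is left out. -/
def thresholdSet (n : ℕ) : Set ℝ :=
  {lam | 0 ≤ lam ∧ ∀ q₀ q₁ : ℝ, psi lam 0 < q₀ → q₀ ≤ q₁ → q₁ ≤ 1 / 2 →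
    (q₁ * (1 - q₁)) ^ ((n - 1) / 2) * (1 - 2 * q₁) / (psi lam 1 - q₁)
      ≤ (q₀ * (1 - q₀)) ^ ((n - 1) / 2) * (1 - 2 * q₀) / (psi lam 1 - q₀)
        * ((2 * lam + Real.log (1 - q₀) - Real.log q₀)
          / (2 * lam - Real.log (1 - q₀) + Real.log q₀))}

/-- The threshold `g(n)`, a supremum in the extended reals; `(n - 1) / 2` above is the floor of the
quotient, for `n ≥ 1`. -/
def threshold (n : ℕ) : EReal :=
  sSup ((fun lam : ℝ => (lam : EReal)) '' thresholdSet n)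

end QuantalVoting

end

noncomputable section

namespace QuantalVoting

/-! ### Margins of report structures -/

/-! Everything is expressed through the margins d(x) = Pr[ω = 1, X = x] - Pr[ω = 0, X = x]: the
utility of f is the sum of d(x)(2f(x) - 1), and the optimal utility is the sum of |d(x)|. For a
c.i.i.d. structure all experts share one posterior function, so the reports form a mixture of two
binomials, with prior c w and vote probability a w in the state w. These depend only on the law of a
single posterior (`rep_eq_binomialReport`), and every law on [0,1] occurs
(`exists_isCIID_posteriorLaw_eq`). The report structures are therefore a continuous image of a
compact set, and the maxima are attained.

Robustness is a minimax argument with a two-point prior on structures. A worst structure for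
majority voting and its mirror image, with states and reports exchanged, give majority voting the
same regret. If majority voting is optimal against their equal mixture, every f has at least that
regret on one of the two. On the mixture the weight of 2f(x) - 1 is proportional to d(x) - d(n - x),
so what is needed is d(n - x) ≤ d(x) for every majority x (`margin_rev_le`).

With a₀ = a false ≤ a₁ = a true, the delicate case is a₁ < 1/2, where votes for 1 are rare in both
states. The claim then reads c₁V(a₁) ≤ c₀V(a₀) with V(b) = b^(n-x)(1-b)^x - b^x(1-b)^(n-x). The
smallest majority is the critical one (`pow_mul_pow_sub_ratio_le`); there V(b) =
(b(1-b))^⌊(n-1)/2⌋(1-2b), the expression in the threshold. It remains to bound c₁/c₀ for given a₀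
and a₁. Write Q = ψ(1) and ψ(p₀) = a₀. The map q ↦ (Q - q)/(logit Q - logit q), a logarithmic mean,
is concave; its tangent at a₀, integrated against the law of the posterior, gives c₁(Q - a₁) ≤ c₀(Q
- a₀)p₀/(1 - p₀) (`prior_mul_le`). The odds p₀/(1 - p₀) equal (2λ + logit a₀)/(2λ - logit a₀), so
the threshold inequality is exactly what closes the estimate. It is inherited by smaller λ and
survives left limits, hence holds for all finite λ ≤ g(n).

For one expert, the optimal utility is at most E|2p - 1| by the triangle inequality, and rational
voting attains this bound. For n ≥ 2, let the posterior be p slightly above 1/2 or exactly 1.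
Rational experts always vote 1 and reveal nothing. At a suitable λ, uncertain experts vote 0 with
probability 1/4 and certain ones almost never; since the state 0 occurs only with the posterior p,
several votes 0 become evidence for it. -/

/-- The joint mass of the state `1` and `x` votes, minus that of the state `0` and `x` votes. -/
def margin {n : ℕ} (r : ReportStructure n) (x : ℕ) : ℝ :=
  prStateVotes r true x - prStateVotes r false x

lemma prStateVotes_nonneg {n : ℕ} {r : ReportStructure n} (hr : ∀ z, 0 ≤ r z) (w : Bool) (x : ℕ) :
    0 ≤ prStateVotes r w x := Finset.sum_nonneg fun _ _ => hr _

/-- Nonnegativity covers the junk value of the division: if Pr[X = x] = 0, both joint masses vanish.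
-/
lemma prVotes_mul_eq_margin {n : ℕ} {r : ReportStructure n} (hr : ∀ z, 0 ≤ r z) (x : ℕ) :
    prVotes r x * (2 * prTrueGivenVotes r x - 1) = margin r x := by
  have h0 := prStateVotes_nonneg hr false x
  have h1 := prStateVotes_nonneg hr true x
  unfold prTrueGivenVotes margin
  by_cases h : prVotes r x = 0
  · have h' := h
    unfold prVotes at h'
    rw [h, show prStateVotes r true x = 0 by linarith, show prStateVotes r false x = 0 by linarith]
    simp
  · have : prVotes r x * (prStateVotes r true x / prVotes r x) = prStateVotes r true x := by
      field_simp
    have h2 : prVotes r x = prStateVotes r false x + prStateVotes r true x := rfl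
    linear_combination 2 * this - h2

lemma utility_eq_sum_margin {n : ℕ} {r : ReportStructure n} (hr : ∀ z, 0 ≤ r z)
    (f : Aggregator n) :
    utility f r = ∑ x : Fin (n + 1), margin r x * (2 * (f x : ℝ) - 1) := by
  unfold utility
  simp_rw [prVotes_mul_eq_margin hr]

lemma mul_two_mul_sub_one_le_abs (d : ℝ) (t : unitInterval) : d * (2 * (t : ℝ) - 1) ≤ |d| := by
  have h0 := t.2.1
  have h1 := t.2.2
  rcases abs_cases d with ⟨h, h'⟩ | ⟨h, h'⟩ <;> rw [h] <;> nlinarith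

lemma utility_omniscient {n : ℕ} {r : ReportStructure n} (hr : ∀ z, 0 ≤ r z) :
    utility (omniscient r) r = ∑ x : Fin (n + 1), |margin r x| := by
  rw [utility_eq_sum_margin hr]
  refine Finset.sum_congr rfl fun x _ => ?_
  have hm := prVotes_mul_eq_margin hr x
  have hp : 0 ≤ prVotes r x :=
    add_nonneg (prStateVotes_nonneg hr _ _) (prStateVotes_nonneg hr _ _)
  unfold omniscient
  split_ifs with h1 h2
  · rw [abs_of_nonneg (by rw [← hm]; exact mul_nonneg hp (by linarith))]
    simp; ring
  · rw [h2] at hm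
    rw [← hm]; simp
  · rw [abs_of_nonpos]
    · simp
    · rw [← hm]
      push Not at h1
      exact mul_nonpos_of_nonneg_of_nonpos hp (by linarith)

lemma regret_eq_sum_margin {n : ℕ} {r : ReportStructure n} (hr : ∀ z, 0 ≤ r z)
    (f : Aggregator n) :
    regret f r = ∑ x : Fin (n + 1), (|margin r x| - margin r x * (2 * (f x : ℝ) - 1)) := by
  rw [regret, utility_omniscient hr, utility_eq_sum_margin hr, Finset.sum_sub_distrib]

lemma maxUtility_eq_sum_abs_margin {n : ℕ} {r : ReportStructure n} (hr : ∀ z, 0 ≤ r z) :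
    maxUtility r = ∑ x : Fin (n + 1), |margin r x| := by
  have h := isGreatest_maxUtility r
  apply le_antisymm
  · obtain ⟨f, hf⟩ := h.1
    rw [← hf]
    simp only
    rw [utility_eq_sum_margin hr]
    exact Finset.sum_le_sum fun x _ => mul_two_mul_sub_one_le_abs _ _
  · rw [← utility_omniscient hr]
    exact h.2 ⟨_, rfl⟩

lemma continuous_margin {n : ℕ} (x : ℕ) : Continuous fun r : ReportStructure n => margin r x := by
  unfold margin prStateVotes
  fun_prop

lemma continuousOn_regret {n : ℕ} (f : Aggregator n) :
    ContinuousOn (regret f) {r : ReportStructure n | ∀ z, 0 ≤ r z} := by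
  have h : Continuous fun r : ReportStructure n =>
      ∑ x : Fin (n + 1), (|margin r x| - margin r x * (2 * (f x : ℝ) - 1)) := by
    have := fun x : Fin (n + 1) => continuous_margin (n := n) x
    fun_prop
  exact h.continuousOn.congr fun r hr => regret_eq_sum_margin hr f

/-! ### Majority voting -/

lemma two_mul_majority_sub_one {n : ℕ} (x : Fin (n + 1)) :
    2 * (majority n x : ℝ) - 1 =
      if 2 * (x : ℕ) < n then -1 else if 2 * (x : ℕ) = n then 0 else 1 := by
  unfold majority
  split_ifs <;> norm_num [fair]

lemma two_mul_majority_rev_sub_one {n : ℕ} (x : Fin (n + 1)) :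
    2 * (majority n x.rev : ℝ) - 1 = -(2 * (majority n x : ℝ) - 1) := by
  rw [two_mul_majority_sub_one, two_mul_majority_sub_one]
  have := x.2
  have h : ((x.rev : Fin (n + 1)) : ℕ) = n - x := by simp [Fin.val_rev]
  rw [h]
  split_ifs <;> first | omega | simp

/-- Majority voting is odd under x ↦ n - x, so exchanging the two states along with the two reports
leaves its regret unchanged. -/
lemma regret_majority_eq_of_margin_rev {n : ℕ} {r r' : ReportStructure n} (hr : ∀ z, 0 ≤ r z)
    (hr' : ∀ z, 0 ≤ r' z)
    (h : ∀ x : Fin (n + 1), margin r' x = -margin r ((x.rev : Fin (n + 1)) : ℕ)) :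
    regret (majority n) r' = regret (majority n) r := by
  rw [regret_eq_sum_margin hr, regret_eq_sum_margin hr', ← Equiv.sum_comp Fin.revPerm]
  refine Finset.sum_congr rfl fun x _ => ?_
  rw [h]
  simp only [Fin.revPerm_apply, Fin.rev_rev, two_mul_majority_rev_sub_one, abs_neg]
  ring

/-- On the equal mixture of a report structure and its mirror image, majority voting is optimal as
soon as the margin is larger at the majority side. -/
lemma regret_majority_add_le {n : ℕ} {r r' : ReportStructure n} (hr : ∀ z, 0 ≤ r z)
    (hr' : ∀ z, 0 ≤ r' z)
    (h : ∀ x : Fin (n + 1), margin r' x = -margin r ((x.rev : Fin (n + 1)) : ℕ))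
    (hm : ∀ x : Fin (n + 1), n < 2 * (x : ℕ) →
      margin r ((x.rev : Fin (n + 1)) : ℕ) ≤ margin r x) (f : Aggregator n) :
    regret (majority n) r + regret (majority n) r' ≤ regret f r + regret f r' := by
  simp only [regret_eq_sum_margin hr, regret_eq_sum_margin hr', ← Finset.sum_add_distrib]
  refine Finset.sum_le_sum fun x _ => ?_
  rw [h x, two_mul_majority_sub_one]
  have h0 := (f x).2.1
  have h1 := (f x).2.2
  have hx := x.2
  have hv : ((x.rev : Fin (n + 1)) : ℕ) = n - x := by simp [Fin.val_rev]
  split_ifs with h2 h3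
  · have := hm x.rev (by omega)
    rw [Fin.rev_rev] at this
    nlinarith
  · rw [hv, show n - (x : ℕ) = x by omega]
    linarith
  · have := hm x (by omega)
    nlinarith

/-! ### Binomial reports -/

/-- The report structure in which the state `w` has probability `c w` and, given the state `w`, the
experts report `1` independently with probability `a w`. -/
def binomialReport (n : ℕ) (c a : Bool → ℝ) : ReportStructure n := fun wr =>
  c wr.1 * ∏ i, if wr.2 i then a wr.1 else 1 - a wr.1

lemma prod_ite_eq_pow_votes {n : ℕ} (y : Fin n → Bool) (a b : ℝ) :
    (∏ i, if y i then a else b) = a ^ votes y * b ^ (n - votes y) := by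
  rw [Finset.prod_ite, Finset.prod_const, Finset.prod_const]
  have h := Finset.card_filter_add_card_filter_not (s := (Finset.univ : Finset (Fin n)))
    (fun i => y i = true)
  simp only [Finset.card_univ, Fintype.card_fin] at h
  have h2 : votes y = (Finset.univ.filter fun i => y i = true).card := rfl
  rw [h2]
  congr 2
  omega

lemma card_filter_votes_eq (n x : ℕ) :
    (Finset.univ.filter fun y : Fin n → Bool => votes y = x).card = n.choose x := by
  have h : (Finset.powersetCard x (Finset.univ : Finset (Fin n))).card = n.choose x := by
    simp [Finset.card_powersetCard]
  rw [← h]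
  refine Finset.card_bij (fun y _ => Finset.univ.filter fun i => y i = true) ?_ ?_ ?_
  · intro y hy
    simp only [Finset.mem_filter, Finset.mem_univ, true_and] at hy
    simp [Finset.mem_powersetCard, ← hy, votes]
  · intro y _ y' _ h
    ext i
    have := congrArg (i ∈ ·) h
    simp only [Finset.mem_filter, Finset.mem_univ, true_and, eq_iff_iff] at this
    exact Bool.eq_iff_iff.mpr this
  · intro s hs
    rw [Finset.mem_powersetCard] at hs
    refine ⟨fun i => decide (i ∈ s), Finset.mem_filter.mpr ⟨Finset.mem_univ _, ?_⟩, ?_⟩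
    · simpa [votes] using hs.2
    · simp

lemma prStateVotes_binomialReport (n : ℕ) (c a : Bool → ℝ) (w : Bool) (x : ℕ) :
    prStateVotes (binomialReport n c a) w x
      = c w * (n.choose x * (a w ^ x * (1 - a w) ^ (n - x))) := by
  unfold prStateVotes binomialReport
  simp only [prod_ite_eq_pow_votes]
  rw [Finset.sum_congr rfl (g := fun _ => c w * (a w ^ x * (1 - a w) ^ (n - x)))]
  · rw [Finset.sum_const, card_filter_votes_eq, nsmul_eq_mul]
    ring
  · intro y hy
    simp only [Finset.mem_filter, Finset.mem_univ, true_and] at hy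
    rw [hy]

lemma margin_binomialReport (n : ℕ) (c a : Bool → ℝ) (x : ℕ) :
    margin (binomialReport n c a) x = n.choose x *
      (c true * (a true ^ x * (1 - a true) ^ (n - x))
        - c false * (a false ^ x * (1 - a false) ^ (n - x))) := by
  rw [margin, prStateVotes_binomialReport, prStateVotes_binomialReport]
  ring

lemma binomialReport_nonneg {n : ℕ} {c a : Bool → ℝ} (hc : ∀ w, 0 ≤ c w) (h0 : ∀ w, 0 ≤ a w)
    (h1 : ∀ w, a w ≤ 1) (z : Bool × (Fin n → Bool)) : 0 ≤ binomialReport n c a z := by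
  refine mul_nonneg (hc _) (Finset.prod_nonneg fun i _ => ?_)
  split_ifs
  · exact h0 _
  · linarith [h1 z.1]

lemma margin_binomialReport_mirror (n : ℕ) (c a : Bool → ℝ) (x : Fin (n + 1)) :
    margin (binomialReport n (fun w => c !w) (fun w => 1 - a !w)) x
      = -margin (binomialReport n c a) ((x.rev : Fin (n + 1)) : ℕ) := by
  have hx := x.2
  have hv : ((x.rev : Fin (n + 1)) : ℕ) = n - x := by simp [Fin.val_rev]
  rw [margin_binomialReport, margin_binomialReport, hv, Nat.choose_symm (by omega),
    show n - (n - (x : ℕ)) = x by omega]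
  simp only [Bool.not_true, Bool.not_false, sub_sub_cancel]
  ring

/-- This is the utility of always guessing 1, the benchmark for the bounded rationality advantage.
-/
lemma sum_margin_binomialReport (n : ℕ) (c a : Bool → ℝ) :
    ∑ x : Fin (n + 1), margin (binomialReport n c a) x = c true - c false := by
  have key : ∀ t : ℝ, ∑ x ∈ Finset.range (n + 1), n.choose x * (t ^ x * (1 - t) ^ (n - x)) = 1 := by
    intro t
    have := add_pow t (1 - t) n
    rw [add_sub_cancel, one_pow] at this
    exact (Finset.sum_congr rfl fun x _ => by ring).trans this.symm
  rw [Fin.sum_univ_eq_sum_range (fun x => margin (binomialReport n c a) x)]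
  have h1 := congrArg (c true * ·) (key (a true))
  have h0 := congrArg (c false * ·) (key (a false))
  simp only [Finset.mul_sum, mul_one] at h1 h0
  rw [← h1, ← h0, ← Finset.sum_sub_distrib]
  refine Finset.sum_congr rfl fun x _ => ?_
  rw [margin_binomialReport]
  ring

/-! ### The law of the posterior -/

/-- The posterior weight of the state `w`. -/
def stateWeight (w : Bool) (p : ℝ) : ℝ := if w then p else 1 - p

namespace SignalStructure

variable {n : ℕ}

lemma posterior_nonneg (θ : SignalStructure n) (i : Fin n) (s : θ.Signal) :
    0 ≤ θ.posterior i s := measureReal_nonneg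

lemma posterior_le_one (θ : SignalStructure n) (i : Fin n) (s : θ.Signal) :
    θ.posterior i s ≤ 1 := measureReal_le_one

lemma measurable_posterior (θ : SignalStructure n) (i : Fin n) : Measurable (θ.posterior i) :=
  (Kernel.measurable_coe _ (measurableSet_singleton true)).ennreal_toReal

/-- The posterior of expert `i` as a point of the unit interval. -/
def unitPosterior (θ : SignalStructure n) (i : Fin n) (s : θ.Signal) : unitInterval :=
  ⟨θ.posterior i s, θ.posterior_nonneg i s, θ.posterior_le_one i s⟩

lemma measurable_unitPosterior (θ : SignalStructure n) (i : Fin n) :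
    Measurable (θ.unitPosterior i) := (θ.measurable_posterior i).subtype_mk

/-- The distribution of the posterior of expert `i`. -/
def posteriorLaw (θ : SignalStructure n) (i : Fin n) : Measure unitInterval :=
  θ.law.map fun z => θ.unitPosterior i (z.2 i)

lemma measurable_signal (θ : SignalStructure n) (i : Fin n) :
    Measurable fun z : Bool × (Fin n → θ.Signal) => z.2 i :=
  (measurable_pi_apply i).comp measurable_snd

instance (θ : SignalStructure n) (i : Fin n) : IsProbabilityMeasure (θ.posteriorLaw i) :=
  Measure.isProbabilityMeasure_map
    ((θ.measurable_unitPosterior i).comp (θ.measurable_signal i)).aemeasurable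

/-- Bayes' rule: disintegrate the joint law of signal and state along the signal. -/
lemma setIntegral_state_true (θ : SignalStructure n) (i : Fin n) {g : θ.Signal → ℝ}
    (hg : Measurable g) {C : ℝ} (hC : ∀ s, ‖g s‖ ≤ C) :
    ∫ z in Prod.fst ⁻¹' {true}, g (z.2 i) ∂θ.law
      = ∫ z, θ.posterior i (z.2 i) * g (z.2 i) ∂θ.law := by
  have hX := θ.measurable_signal i
  have hY : Measurable (Prod.fst : Bool × (Fin n → θ.Signal) → Bool) := measurable_fst
  have hXY : Measurable fun z : Bool × (Fin n → θ.Signal) => (z.2 i, z.1) := hX.prodMk hY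
  let F : θ.Signal × Bool → ℝ := fun q => if q.2 = true then g q.1 else 0
  have hF : Measurable F := by
    refine Measurable.ite ?_ (hg.comp measurable_fst) measurable_const
    exact measurable_snd (measurableSet_singleton true)
  have hFC : ∀ q, ‖F q‖ ≤ C := by
    intro q
    simp only [F]
    split_ifs
    · exact hC _
    · simpa using (norm_nonneg _).trans (hC q.1)
  have hcomp : (θ.law.map fun z => z.2 i) ⊗ₘ condDistrib (Prod.fst :
      Bool × (Fin n → θ.Signal) → Bool) (fun z => z.2 i) θ.law
      = θ.law.map fun z => (z.2 i, z.1) := compProd_map_condDistrib hY.aemeasurable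
  have : IsProbabilityMeasure (θ.law.map fun z => z.2 i) :=
    Measure.isProbabilityMeasure_map hX.aemeasurable
  calc ∫ z in Prod.fst ⁻¹' {true}, g (z.2 i) ∂θ.law
      = ∫ z, F (z.2 i, z.1) ∂θ.law := by
        rw [← integral_indicator (hY (measurableSet_singleton true))]
        refine integral_congr_ae (Filter.Eventually.of_forall fun z => ?_)
        by_cases h : z.1 = true <;> simp [F, h, indicator]
    _ = ∫ q, F q ∂(θ.law.map fun z => (z.2 i, z.1)) :=
        (integral_map hXY.aemeasurable hF.aestronglyMeasurable).symm
    _ = ∫ s, ∫ b, F (s, b) ∂(condDistrib (Prod.fst :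
          Bool × (Fin n → θ.Signal) → Bool) (fun z => z.2 i) θ.law s)
          ∂(θ.law.map fun z => z.2 i) := by
        rw [← hcomp, Measure.integral_compProd]
        exact Integrable.of_bound hF.aestronglyMeasurable C (Filter.Eventually.of_forall hFC)
    _ = ∫ s, θ.posterior i s * g s ∂(θ.law.map fun z => z.2 i) := by
        congr 1
        ext s
        rw [integral_fintype Integrable.of_finite]
        simp [F, posterior]
    _ = _ := integral_map hX.aemeasurable
        (((θ.measurable_posterior i).mul hg).aestronglyMeasurable)

lemma setIntegral_state (θ : SignalStructure n) (i : Fin n) {g : θ.Signal → ℝ}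
    (hg : Measurable g) {C : ℝ} (hC : ∀ s, ‖g s‖ ≤ C) (w : Bool) :
    ∫ z in Prod.fst ⁻¹' {w}, g (z.2 i) ∂θ.law
      = ∫ z, stateWeight w (θ.posterior i (z.2 i)) * g (z.2 i) ∂θ.law := by
  have hX := θ.measurable_signal i
  have hi : Integrable (fun z : Bool × (Fin n → θ.Signal) => g (z.2 i)) θ.law :=
    Integrable.of_bound (hg.comp hX).aestronglyMeasurable C
      (Filter.Eventually.of_forall fun z => hC _)
  have hi' : Integrable (fun z : Bool × (Fin n → θ.Signal) =>
      θ.posterior i (z.2 i) * g (z.2 i)) θ.law := by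
    refine Integrable.of_bound
      (((θ.measurable_posterior i).mul hg).comp hX).aestronglyMeasurable C
      (Filter.Eventually.of_forall fun z => ?_)
    rw [norm_mul, Real.norm_of_nonneg (θ.posterior_nonneg _ _)]
    exact (mul_le_of_le_one_left (norm_nonneg _) (θ.posterior_le_one _ _)).trans (hC _)
  cases w
  · have hs : MeasurableSet (Prod.fst ⁻¹' {true} : Set (Bool × (Fin n → θ.Signal))) :=
      measurable_fst (measurableSet_singleton true)
    have h := integral_add_compl hs hi
    have hc : (Prod.fst ⁻¹' {true} : Set (Bool × (Fin n → θ.Signal)))ᶜ = Prod.fst ⁻¹' {false} := by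
      ext z; simp
    rw [hc, setIntegral_state_true θ i hg hC] at h
    simp only [stateWeight, Bool.false_eq_true, if_false, sub_mul, one_mul]
    rw [integral_sub hi hi']
    linarith
  · simpa [stateWeight] using setIntegral_state_true θ i hg hC

lemma setIntegral_comp_posterior (θ : SignalStructure n) (i : Fin n) {ψ : ℝ → ℝ}
    (hψ : Measurable ψ) {C : ℝ} (hC : ∀ p, ‖ψ p‖ ≤ C) (w : Bool) :
    ∫ z in Prod.fst ⁻¹' {w}, ψ (θ.posterior i (z.2 i)) ∂θ.law
      = ∫ p : unitInterval, stateWeight w p * ψ p ∂(θ.posteriorLaw i) := by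
  rw [setIntegral_state θ i (g := fun s => ψ (θ.posterior i s))
    (hψ.comp (θ.measurable_posterior i)) (fun s => hC _) w, posteriorLaw, integral_map]
  · rfl
  · exact ((θ.measurable_unitPosterior i).comp (θ.measurable_signal i)).aemeasurable
  · refine Measurable.aestronglyMeasurable (Measurable.mul ?_ (hψ.comp measurable_subtype_coe))
    cases w
    · exact measurable_const.sub measurable_subtype_coe
    · exact measurable_subtype_coe

lemma measureReal_state (θ : SignalStructure n) (i : Fin n) (w : Bool) :
    θ.law.real (Prod.fst ⁻¹' {w})
      = ∫ p : unitInterval, stateWeight w p ∂(θ.posteriorLaw i) := by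
  have := setIntegral_comp_posterior θ i (ψ := fun _ => 1) measurable_const
    (C := 1) (by simp) w
  simpa using this

lemma IsCIID.map_restrict {θ : SignalStructure n} (h : θ.IsCIID) (w : Bool)
    (hw : θ.law (Prod.fst ⁻¹' {w}) ≠ 0) :
    ∃ κ : ProbabilityMeasure θ.Signal,
      (θ.law.restrict (Prod.fst ⁻¹' {w})).map Prod.snd
        = θ.law (Prod.fst ⁻¹' {w}) • Measure.pi fun _ : Fin n => (κ : Measure θ.Signal) := by
  obtain ⟨κ, hκ⟩ := h w hw
  refine ⟨κ, ?_⟩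
  rw [← hκ, ProbabilityTheory.cond, Measure.map_smul, smul_smul,
    ENNReal.mul_inv_cancel hw (measure_ne_top _ _), one_smul]

lemma IsCIID.map_signal_state_eq {θ : SignalStructure n} (h : θ.IsCIID) (i j : Fin n) :
    (θ.law.map fun z => (z.2 i, z.1)) = θ.law.map fun z => (z.2 j, z.1) := by
  have hs (w : Bool) : MeasurableSet (Prod.fst ⁻¹' {w} : Set (Bool × (Fin n → θ.Signal))) :=
    measurable_fst (measurableSet_singleton w)
  have key : ∀ (w : Bool) (i : Fin n),
      (θ.law.restrict (Prod.fst ⁻¹' {w})).map (fun z => (z.2 i, z.1))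
        = (((θ.law.restrict (Prod.fst ⁻¹' {w})).map Prod.snd).map (Function.eval i)).map
          (fun s => (s, w)) := by
    intro w i
    have hw : Measurable fun s : θ.Signal => (s, w) := measurable_prodMk_right
    have he : Measurable (Function.eval i : (Fin n → θ.Signal) → θ.Signal) := measurable_pi_apply i
    rw [Measure.map_map he measurable_snd, Measure.map_map hw (he.comp measurable_snd)]
    refine Measure.map_congr ?_
    filter_upwards [ae_restrict_mem (hs w)] with z hz
    simp only [Function.comp, Function.eval]
    rw [show z.1 = w from hz]
  have key2 : ∀ w : Bool,
      ((θ.law.restrict (Prod.fst ⁻¹' {w})).map Prod.snd).map (Function.eval i)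
        = ((θ.law.restrict (Prod.fst ⁻¹' {w})).map Prod.snd).map (Function.eval j) := by
    intro w
    by_cases hw : θ.law (Prod.fst ⁻¹' {w}) = 0
    · rw [Measure.restrict_eq_zero.mpr hw]; simp
    · obtain ⟨κ, hκ⟩ := h.map_restrict w hw
      rw [hκ, Measure.map_smul, Measure.map_smul,
        (measurePreserving_eval (fun _ : Fin n => (κ : Measure θ.Signal)) i).map_eq,
        (measurePreserving_eval (fun _ : Fin n => (κ : Measure θ.Signal)) j).map_eq]
  have hsplit : θ.law = θ.law.restrict (Prod.fst ⁻¹' {true})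
      + θ.law.restrict (Prod.fst ⁻¹' {false}) := by
    conv_lhs => rw [← Measure.restrict_add_restrict_compl (μ := θ.law) (hs true)]
    congr 2
    ext z; simp
  rw [hsplit, Measure.map_add _ _ ((θ.measurable_signal i).prodMk measurable_fst),
    Measure.map_add _ _ ((θ.measurable_signal j).prodMk measurable_fst),
    key, key, key, key, key2, key2]

/-- `condDistrib` is built from the joint law of the signal and the state alone, and this law is the
same for all experts; hence equality everywhere, not just almost everywhere. -/
lemma IsCIID.posterior_eq {θ : SignalStructure n} (h : θ.IsCIID) (i j : Fin n) :
    θ.posterior i = θ.posterior j := by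
  ext s
  unfold posterior
  rw [condDistrib, condDistrib]
  simp only [h.map_signal_state_eq i j]

end SignalStructure

/-- `c w` is the probability of the state `w`, and `a w` the probability of a report `1` given the
state `w`, when the posterior of each expert has the distribution `m`. -/
structure IsVoteProfile (ψ : ℝ → ℝ) (m : Measure unitInterval) (c a : Bool → ℝ) : Prop where
  prior : ∀ w, c w = ∫ p : unitInterval, stateWeight w p ∂m
  vote : ∀ w, c w * a w = ∫ p : unitInterval, stateWeight w p * ψ p ∂m

/-- Given a state, the signals have a product law and the posterior functions coincide, so the
integral of the product of report probabilities factors into equal means. In a state of probability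
zero both sides vanish, whatever `a` is there. -/
theorem SignalStructure.IsCIID.rep_eq_binomialReport {n : ℕ} {θ : SignalStructure n}
    (h : θ.IsCIID) (i₀ : Fin n) {ψ : ℝ → ℝ} (hψ : Measurable ψ) (h0 : ∀ p, 0 ≤ ψ p)
    (h1 : ∀ p, ψ p ≤ 1) {c a : Bool → ℝ} (hca : IsVoteProfile ψ (θ.posteriorLaw i₀) c a) :
    rep θ ψ = binomialReport n c a := by
  ext ⟨w, y⟩
  have hC : ∀ p, ‖ψ p‖ ≤ 1 := fun p => by rw [Real.norm_of_nonneg (h0 p)]; exact h1 p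
  unfold rep binomialReport
  simp only
  have hcw : θ.law.real (Prod.fst ⁻¹' {w}) = c w := by
    rw [θ.measureReal_state i₀, hca.prior]
  by_cases hw : θ.law (Prod.fst ⁻¹' {w}) = 0
  · rw [Measure.restrict_eq_zero.mpr hw, ← hcw, measureReal_def, hw]
    simp
  obtain ⟨κ, hκ⟩ := h.map_restrict w hw
  have hpos : c w ≠ 0 := by
    rw [← hcw, measureReal_def]
    exact (ENNReal.toReal_pos hw (measure_ne_top _ _)).ne'
  have hmeas : Measurable fun s => ψ (θ.posterior i₀ s) := hψ.comp (θ.measurable_posterior i₀)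
  have hmean : ∫ s, ψ (θ.posterior i₀ s) ∂(κ : Measure θ.Signal) = a w := by
    have e1 := θ.setIntegral_comp_posterior i₀ hψ hC w
    have e2 : ∫ z in Prod.fst ⁻¹' {w}, ψ (θ.posterior i₀ (z.2 i₀)) ∂θ.law
        = c w * ∫ s, ψ (θ.posterior i₀ s) ∂(κ : Measure θ.Signal) := by
      have e3 := (measurePreserving_eval (fun _ : Fin n => (κ : Measure θ.Signal)) i₀).map_eq
      rw [← e3, integral_map (measurable_pi_apply i₀).aemeasurable hmeas.aestronglyMeasurable,
        ← hcw, measureReal_def, ← smul_eq_mul, ← integral_smul_measure, ← hκ,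
        integral_map measurable_snd.aemeasurable]
      exact (hmeas.comp (measurable_pi_apply i₀)).aestronglyMeasurable
    rw [e2, ← hca.vote] at e1
    exact mul_left_cancel₀ hpos e1
  let g : Fin n → θ.Signal → ℝ := fun i s =>
    if y i then ψ (θ.posterior i₀ s) else 1 - ψ (θ.posterior i₀ s)
  have hg : ∀ i, Measurable (g i) := by
    intro i
    simp only [g]
    split_ifs
    · exact hmeas
    · exact measurable_const.sub hmeas
  have hint : Integrable (fun s => ψ (θ.posterior i₀ s)) (κ : Measure θ.Signal) :=
    Integrable.of_bound hmeas.aestronglyMeasurable 1 (Filter.Eventually.of_forall fun s => hC _)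
  have hgi : ∀ i, ∫ s, g i s ∂(κ : Measure θ.Signal) = if y i then a w else 1 - a w := by
    intro i
    simp only [g]
    split_ifs
    · exact hmean
    · rw [integral_sub (integrable_const _) hint, hmean]
      simp
  have hprod : Measurable fun s : Fin n → θ.Signal => ∏ i, g i (s i) :=
    Finset.measurable_prod _ fun i _ => (hg i).comp (measurable_pi_apply i)
  calc _ = ∫ z in Prod.fst ⁻¹' {w}, ∏ i, g i (z.2 i) ∂θ.law := by
        simp only [g, fun i => h.posterior_eq i i₀]
    _ = ∫ s, ∏ i, g i (s i) ∂(θ.law.restrict (Prod.fst ⁻¹' {w})).map Prod.snd :=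
        (integral_map measurable_snd.aemeasurable hprod.aestronglyMeasurable).symm
    _ = c w * ∏ i, ∫ s, g i s ∂(κ : Measure θ.Signal) := by
        rw [hκ, integral_smul_measure, ← measureReal_def, hcw, smul_eq_mul,
          integral_fintype_prod_eq_prod]
    _ = _ := by simp only [hgi]

/-! ### Signal structures with a given law of the posterior -/

lemma exists_probabilityMeasure_smul {α : Type*} [MeasurableSpace α] [Nonempty α]
    (ν : Measure α) [IsFiniteMeasure ν] :
    ∃ κ : ProbabilityMeasure α, ν = ν univ • (κ : Measure α) := by
  by_cases h : ν = 0
  · refine ⟨⟨Measure.dirac (Classical.arbitrary α), inferInstance⟩, ?_⟩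
    simp [h]
  · have hu : ν univ ≠ 0 := by simpa using h
    refine ⟨⟨(ν univ)⁻¹ • ν, ⟨?_⟩⟩, ?_⟩
    · rw [Measure.smul_apply, smul_eq_mul, ENNReal.inv_mul_cancel hu (measure_ne_top _ _)]
    · rw [ProbabilityMeasure.coe_mk, smul_smul, ENNReal.mul_inv_cancel hu (measure_ne_top _ _),
        one_smul]

/-- Every distribution on the unit interval is the law of the posterior of a c.i.i.d. signal
structure. -/
theorem exists_isCIID_posteriorLaw_eq {n : ℕ} (i : Fin n) (m : ProbabilityMeasure unitInterval) :
    ∃ θ : SignalStructure n, θ.IsCIID ∧ θ.posteriorLaw i = m := by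
  let μ : Measure unitInterval := m
  -- The signal will be the posterior itself: its joint law with the state `w` has density `p` or `1
  -- - p` with respect to `m`.
  let ν : Bool → Measure unitInterval := fun w =>
    μ.withDensity fun p => ENNReal.ofReal (stateWeight w p)
  have hmw : ∀ w, Measurable fun p : unitInterval => stateWeight w p := by
    intro w
    cases w
    · exact measurable_const.sub measurable_subtype_coe
    · exact measurable_subtype_coe
  have hw0 : ∀ w (p : unitInterval), 0 ≤ stateWeight w p := by
    intro w p
    cases w
    · simpa [stateWeight] using p.2.2
    · simpa [stateWeight] using p.2.1
  have hν : ν true + ν false = μ := by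
    rw [← withDensity_add_left (hmw true).ennreal_ofReal]
    conv_rhs => rw [← withDensity_one (μ := μ)]
    congr 1
    ext p
    simp only [Pi.add_apply, Pi.one_apply]
    rw [← ENNReal.ofReal_add (hw0 _ _) (hw0 _ _)]
    simp [stateWeight]
  have hνle : ∀ w, ν w ≤ μ := by
    intro w
    cases w
    · conv_rhs => rw [← hν]
      exact Measure.le_add_left le_rfl
    · conv_rhs => rw [← hν]
      exact Measure.le_add_right le_rfl
  have hfin : ∀ w, IsFiniteMeasure (ν w) := fun w => isFiniteMeasure_of_le μ (hνle w)
  choose κ hκ using fun w => exists_probabilityMeasure_smul (ν w)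
  let ρ : Bool → Measure (Bool × (Fin n → unitInterval)) := fun w =>
    (ν w univ) • (Measure.pi fun _ : Fin n => (κ w : Measure unitInterval)).map (Prod.mk w)
  have hρ : ∀ w s, MeasurableSet s → ρ w s = ν w univ *
      (Measure.pi fun _ : Fin n => (κ w : Measure unitInterval)) (Prod.mk w ⁻¹' s) := by
    intro w s hs
    simp only [ρ, Measure.smul_apply, smul_eq_mul]
    rw [Measure.map_apply measurable_prodMk_left hs]
  have hprob : IsProbabilityMeasure (ρ true + ρ false) := by
    constructor
    rw [Measure.add_apply, hρ _ _ MeasurableSet.univ, hρ _ _ MeasurableSet.univ]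
    simp only [preimage_univ, measure_univ, mul_one]
    rw [← Measure.add_apply, hν]
    exact measure_univ
  have hrestrict : ∀ w, (ρ true + ρ false).restrict (Prod.fst ⁻¹' {w}) = ρ w := by
    have hs (w : Bool) : MeasurableSet
        (Prod.fst ⁻¹' {w} : Set (Bool × (Fin n → unitInterval))) :=
      measurable_fst (measurableSet_singleton w)
    have hself : ∀ w, (ρ w).restrict (Prod.fst ⁻¹' {w}) = ρ w := by
      intro w
      refine Measure.restrict_eq_self_of_ae_mem ?_
      rw [ae_iff]
      change ρ w (Prod.fst ⁻¹' {w})ᶜ = 0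
      rw [hρ _ _ (hs w).compl]
      have : Prod.mk w ⁻¹' (Prod.fst ⁻¹' {w})ᶜ = (∅ : Set (Fin n → unitInterval)) := by
        ext; simp
      rw [this]; simp
    have hother : ∀ w, (ρ (!w)).restrict (Prod.fst ⁻¹' {w}) = 0 := by
      intro w
      rw [Measure.restrict_eq_zero, hρ _ _ (hs w)]
      have : Prod.mk (!w) ⁻¹' (Prod.fst ⁻¹' {w}) = (∅ : Set (Fin n → unitInterval)) := by
        ext; simp
      rw [this]; simp
    intro w
    rw [Measure.restrict_add]
    cases w
    · rw [hself, show ρ true = ρ (!false) from rfl, hother, zero_add]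
    · rw [hself, show ρ false = ρ (!true) from rfl, hother, add_zero]
  have hsnd : ∀ w, (ρ w).map Prod.snd
      = ν w univ • Measure.pi fun _ : Fin n => (κ w : Measure unitInterval) := by
    intro w
    simp only [ρ]
    rw [Measure.map_smul, Measure.map_map measurable_snd measurable_prodMk_left]
    simp [Function.comp_def]
  have hmarg : ∀ w j, (ρ w).map (fun z => z.2 j) = ν w := by
    intro w j
    have : (fun z : Bool × (Fin n → unitInterval) => z.2 j) = Function.eval j ∘ Prod.snd := rfl
    rw [this, ← Measure.map_map (measurable_pi_apply j) measurable_snd, hsnd, Measure.map_smul,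
      (measurePreserving_eval (fun _ : Fin n => (κ w : Measure unitInterval)) j).map_eq, ← hκ]
  let θ : SignalStructure n := { Signal := unitInterval, law := ρ true + ρ false }
  refine ⟨θ, ?_, ?_⟩
  · intro w hw
    refine ⟨κ w, ?_⟩
    have hmass : θ.law (Prod.fst ⁻¹' {w}) = ν w univ := by
      rw [← Measure.restrict_apply_univ, show θ.law.restrict _ = ρ w from hrestrict w,
        hρ _ _ MeasurableSet.univ]
      simp
    rw [hmass] at hw
    rw [ProbabilityTheory.cond, hmass, show θ.law.restrict _ = ρ w from hrestrict w, Measure.map_smul, hsnd,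
      smul_smul, ENNReal.inv_mul_cancel hw (measure_ne_top _ _), one_smul]
  · have hX := θ.measurable_signal i
    have hmap : θ.law.map (fun z => z.2 i) = μ := by
      change (ρ true + ρ false).map _ = μ
      rw [Measure.map_add _ _ hX, hmarg, hmarg, hν]
    have hae : θ.unitPosterior i =ᵐ[μ] id := by
      -- Over every measurable set both functions integrate to the mass that `ν true` gives it.
      have h : θ.posterior i =ᵐ[μ] fun p : unitInterval => (p : ℝ) := by
        refine ae_eq_of_forall_setIntegral_eq_of_sigmaFinite ?_ ?_ ?_
        · intro s _ _
          exact (Integrable.of_bound (θ.measurable_posterior i).aestronglyMeasurable 1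
            (Filter.Eventually.of_forall fun z => by
              rw [Real.norm_of_nonneg (θ.posterior_nonneg _ _)]
              exact θ.posterior_le_one _ _)).integrableOn
        · intro s _ _
          exact (Integrable.of_bound measurable_subtype_coe.aestronglyMeasurable 1
            (Filter.Eventually.of_forall fun z : unitInterval => by
              rw [Real.norm_of_nonneg z.2.1]
              exact z.2.2)).integrableOn
        · intro s hs _
          have hind : Measurable (s.indicator (1 : unitInterval → ℝ)) :=
            measurable_one.indicator hs
          have hb : ∀ p, ‖s.indicator (1 : unitInterval → ℝ) p‖ ≤ 1 := by
            intro p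
            by_cases hp : p ∈ s <;> simp [hp]
          have e := θ.setIntegral_state i (g := s.indicator (1 : unitInterval → ℝ)) hind hb true
          rw [show θ.law.restrict _ = ρ true from hrestrict true] at e
          rw [← integral_map (φ := fun z : Bool × (Fin n → unitInterval) => z.2 i)
            (f := s.indicator (1 : unitInterval → ℝ)) hX.aemeasurable hind.aestronglyMeasurable,
            hmarg true i,
            ← integral_map (φ := fun z : Bool × (Fin n → unitInterval) => z.2 i)
              (f := fun p => stateWeight true (θ.posterior i p)
                * s.indicator (1 : unitInterval → ℝ) p) hX.aemeasurable
              ((θ.measurable_posterior i).mul hind).aestronglyMeasurable] at e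
          rw [hmap, integral_withDensity_eq_integral_toReal_smul
            (hmw true).ennreal_ofReal (by simp)] at e
          have hl : ∀ u : unitInterval → ℝ, ∫ p in s, u p ∂μ
              = ∫ p, u p * s.indicator (1 : unitInterval → ℝ) p ∂μ := by
            intro u
            rw [← integral_indicator hs]
            congr 1
            ext p
            by_cases hp : p ∈ s <;> simp [hp]
          rw [hl, hl]
          refine Eq.trans ?_ (e.symm.trans ?_)
          · simp [stateWeight]
          · congr 1
            ext p
            rw [ENNReal.toReal_ofReal (hw0 _ _)]
            simp [stateWeight]
      filter_upwards [h] with p hp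
      exact Subtype.ext hp
    have : (fun z : Bool × (Fin n → unitInterval) => θ.unitPosterior i (z.2 i))
        = θ.unitPosterior i ∘ fun z => z.2 i := rfl
    rw [SignalStructure.posteriorLaw]
    change θ.law.map (θ.unitPosterior i ∘ fun z => z.2 i) = μ
    rw [← Measure.map_map (θ.measurable_unitPosterior i) hX, hmap, Measure.map_congr hae,
      Measure.map_id]

/-! ### Response functions -/

lemma psi_eq (lam p : ℝ) : psi lam p = (1 + Real.exp (-(2 * lam * (2 * p - 1))))⁻¹ := by
  unfold psi quantalResponse
  rw [one_div]
  congr 3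
  ring

lemma psi_pos (lam p : ℝ) : 0 < psi lam p := by
  rw [psi_eq]; positivity

lemma psi_lt_one (lam p : ℝ) : psi lam p < 1 := by
  rw [psi_eq]
  exact inv_lt_one_of_one_lt₀ (by linarith [Real.exp_pos (-(2 * lam * (2 * p - 1)))])

lemma continuous_psi (lam : ℝ) : Continuous (psi lam) := by
  have h : psi lam = fun p => (1 + Real.exp (-(2 * lam * (2 * p - 1))))⁻¹ := funext (psi_eq lam)
  rw [h]
  exact Continuous.inv₀ (by fun_prop) fun p => by positivity

lemma monotone_psi {lam : ℝ} (h : 0 ≤ lam) : Monotone (psi lam) := by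
  intro p q hpq
  rw [psi_eq, psi_eq]
  gcongr

lemma psi_one_sub (lam p : ℝ) : psi lam (1 - p) = 1 - psi lam p := by
  rw [psi_eq, psi_eq, show -(2 * lam * (2 * (1 - p) - 1)) = 2 * lam * (2 * p - 1) by ring,
    Real.exp_neg]
  have := Real.exp_pos (2 * lam * (2 * p - 1))
  field_simp
  ring

lemma psiInfty_nonneg (p : ℝ) : 0 ≤ psiInfty p := by
  unfold psiInfty; split_ifs <;> norm_num

lemma psiInfty_le_one (p : ℝ) : psiInfty p ≤ 1 := by
  unfold psiInfty; split_ifs <;> norm_num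

lemma measurable_psiInfty : Measurable psiInfty := by
  unfold psiInfty
  refine Measurable.ite (measurableSet_lt measurable_const measurable_id) measurable_const ?_
  exact Measurable.ite (measurableSet_eq_fun measurable_id measurable_const) measurable_const
    measurable_const

/-! ### Vote profiles -/

lemma measurable_stateWeight (w : Bool) : Measurable (stateWeight w) := by
  cases w
  · exact measurable_const.sub measurable_id
  · exact measurable_id

lemma stateWeight_nonneg (w : Bool) (p : unitInterval) : 0 ≤ stateWeight w p := by
  cases w
  · simpa [stateWeight] using p.2.2
  · simpa [stateWeight] using p.2.1

lemma stateWeight_le_one (w : Bool) (p : unitInterval) : stateWeight w p ≤ 1 := by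
  cases w
  · simpa [stateWeight] using p.2.1
  · simpa [stateWeight] using p.2.2

lemma integrable_unitInterval (m : Measure unitInterval) [IsFiniteMeasure m] {g : ℝ → ℝ}
    (hg : Measurable g) {C : ℝ} (hC : ∀ p : unitInterval, |g p| ≤ C) :
    Integrable (fun p : unitInterval => g p) m :=
  Integrable.of_bound (hg.comp measurable_subtype_coe).aestronglyMeasurable C
    (Filter.Eventually.of_forall hC)

lemma integrable_stateWeight_mul (m : Measure unitInterval) [IsFiniteMeasure m] (w : Bool)
    {ψ : ℝ → ℝ} (hψ : Measurable ψ) {C : ℝ} (hC : ∀ p, |ψ p| ≤ C) :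
    Integrable (fun p : unitInterval => stateWeight w p * ψ p) m := by
  refine integrable_unitInterval m (g := fun p => stateWeight w p * ψ p)
    ((measurable_stateWeight w).mul hψ) (C := C) fun p => ?_
  rw [abs_mul, abs_of_nonneg (stateWeight_nonneg w p)]
  exact (mul_le_of_le_one_left (abs_nonneg _) (stateWeight_le_one w p)).trans (hC _)

lemma integrable_stateWeight (m : Measure unitInterval) [IsFiniteMeasure m] (w : Bool) :
    Integrable (fun p : unitInterval => stateWeight w p) m :=
  integrable_unitInterval m (measurable_stateWeight w) (C := 1) fun p => by
    rw [abs_of_nonneg (stateWeight_nonneg w p)]; exact stateWeight_le_one w p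

namespace IsVoteProfile

variable {ψ : ℝ → ℝ} {m : Measure unitInterval} {c a : Bool → ℝ}

lemma prior_nonneg (h : IsVoteProfile ψ m c a) (w : Bool) : 0 ≤ c w := by
  rw [h.prior]
  exact integral_nonneg fun p => stateWeight_nonneg w p

lemma prior_add_prior [IsProbabilityMeasure m] (h : IsVoteProfile ψ m c a) :
    c false + c true = 1 := by
  rw [h.prior, h.prior, ← integral_add (integrable_stateWeight m _) (integrable_stateWeight m _)]
  simp [stateWeight]

lemma mirror [IsProbabilityMeasure m] (hψ : Measurable ψ) {C : ℝ} (hC : ∀ p, |ψ p| ≤ C)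
    (hsymm : ∀ p, ψ (1 - p) = 1 - ψ p) (h : IsVoteProfile ψ m c a) :
    IsVoteProfile ψ (m.map unitInterval.symm) (fun w => c !w) (fun w => 1 - a !w) := by
  have hs : Measurable unitInterval.symm := unitInterval.continuous_symm.measurable
  have hw : ∀ w (p : unitInterval), stateWeight w (1 - (p : ℝ)) = stateWeight (!w) p := by
    intro w p
    cases w <;> simp [stateWeight]
  constructor
  · intro w
    rw [integral_map (f := fun p : unitInterval => stateWeight w p) hs.aemeasurable
      ((measurable_stateWeight w).comp measurable_subtype_coe).aestronglyMeasurable, h.prior]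
    simp only [unitInterval.coe_symm_eq, hw]
  · intro w
    rw [integral_map (f := fun p : unitInterval => stateWeight w p * ψ p) hs.aemeasurable
      (((measurable_stateWeight w).mul hψ).comp measurable_subtype_coe).aestronglyMeasurable]
    simp only [unitInterval.coe_symm_eq, hw, hsymm, mul_sub, mul_one]
    rw [integral_sub (integrable_stateWeight m _) (integrable_stateWeight_mul m _ hψ hC),
      ← h.prior, ← h.vote]

end IsVoteProfile

/-- A monotone response function yields more votes for the state `1` in the state `1`. -/
theorem exists_isVoteProfile (m : Measure unitInterval) [IsProbabilityMeasure m] {ψ : ℝ → ℝ}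
    (hψ : Measurable ψ) (hmono : Monotone ψ) {l u : ℝ} (hl : ∀ p ∈ Icc (0 : ℝ) 1, l ≤ ψ p)
    (hu : ∀ p ∈ Icc (0 : ℝ) 1, ψ p ≤ u) :
    ∃ c a : Bool → ℝ, IsVoteProfile ψ m c a ∧ (∀ w, l ≤ a w) ∧ (∀ w, a w ≤ u) ∧
      a false ≤ a true := by
  have hlu : l ≤ u := (hl 0 (by simp)).trans (hu 0 (by simp))
  set c : Bool → ℝ := fun w => ∫ p : unitInterval, stateWeight w p ∂m with hc
  set b : Bool → ℝ := fun w => ∫ p : unitInterval, stateWeight w p * ψ p ∂m with hb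
  have hC : ∀ p : unitInterval, |ψ p| ≤ max |l| |u| := fun p =>
    abs_le_max_abs_abs (hl p p.2) (hu p p.2)
  have hint : ∀ w, Integrable (fun p : unitInterval => stateWeight w p * ψ p) m := by
    intro w
    refine integrable_unitInterval m (g := fun p => stateWeight w p * ψ p)
      ((measurable_stateWeight w).mul hψ) (C := max |l| |u|) fun p => ?_
    rw [abs_mul, abs_of_nonneg (stateWeight_nonneg w p)]
    exact (mul_le_of_le_one_left (abs_nonneg _) (stateWeight_le_one w p)).trans (hC _)
  have hc0 : ∀ w, 0 ≤ c w := fun w => integral_nonneg fun p => stateWeight_nonneg w p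
  have hbl : ∀ w, c w * l ≤ b w := by
    intro w
    rw [hc, hb]
    simp only
    rw [← integral_mul_const]
    exact integral_mono ((integrable_stateWeight m w).mul_const l) (hint w) fun p =>
      mul_le_mul_of_nonneg_left (hl p p.2) (stateWeight_nonneg w p)
  have hbu : ∀ w, b w ≤ c w * u := by
    intro w
    rw [hc, hb]
    simp only
    rw [← integral_mul_const]
    exact integral_mono (hint w) ((integrable_stateWeight m w).mul_const u) fun p =>
      mul_le_mul_of_nonneg_left (hu p p.2) (stateWeight_nonneg w p)
  have hsum : c false + c true = 1 := by
    simp only [hc]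
    rw [← integral_add (integrable_stateWeight m _) (integrable_stateWeight m _)]
    simp [stateWeight]
  -- Chebyshev's association inequality: `p` and `ψ p` are nonnegatively correlated, as (p - μ)(ψ p
  -- - ψ μ) ≥ 0 with μ the mean posterior.
  have hcov : c true * b false ≤ c false * b true := by
    set μ := c true with hμ
    have hi : ∀ w, Integrable (fun p : unitInterval => stateWeight w p) m :=
      integrable_stateWeight m
    have i1 : Integrable (fun p : unitInterval => (1 - μ) * (stateWeight true p * ψ p)) m :=
      (hint true).const_mul _
    have i0 : Integrable (fun p : unitInterval => μ * (stateWeight false p * ψ p)) m :=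
      (hint false).const_mul _
    have j1 : Integrable (fun p : unitInterval => (1 - μ) * stateWeight true p) m :=
      (hi true).const_mul _
    have j0 : Integrable (fun p : unitInterval => μ * stateWeight false p) m :=
      (hi false).const_mul _
    have i10 : Integrable (fun p : unitInterval =>
      (1 - μ) * (stateWeight true p * ψ p) - μ * (stateWeight false p * ψ p)) m := i1.sub i0
    have j10 : Integrable (fun p : unitInterval =>
      ((1 - μ) * stateWeight true p - μ * stateWeight false p) * ψ μ) m := (j1.sub j0).mul_const _
    have h1 : 0 ≤ ∫ p : unitInterval,
        ((1 - μ) * (stateWeight true p * ψ p) - μ * (stateWeight false p * ψ p)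
          - ((1 - μ) * stateWeight true p - μ * stateWeight false p) * ψ μ) ∂m := by
      refine integral_nonneg fun p => ?_
      simp only [stateWeight, Bool.false_eq_true, if_false, if_true, Pi.zero_apply]
      rcases le_total (p : ℝ) μ with h | h
      · nlinarith [hmono h]
      · nlinarith [hmono h]
    rw [integral_sub i10 j10, integral_sub i1 i0, integral_mul_const, integral_sub j1 j0,
      integral_const_mul, integral_const_mul, integral_const_mul, integral_const_mul] at h1
    change 0 ≤ (1 - μ) * b true - μ * b false - ((1 - μ) * μ - μ * c false) * ψ μ at h1
    have e : c false = 1 - μ := by linarith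
    rw [e] at h1 ⊢
    linarith
  -- In a null state the vote probability is free; the extreme values `u` and `l` keep `a false ≤ a
  -- true`.
  refine ⟨c, fun w => if c w = 0 then (if w then u else l) else b w / c w, ⟨fun w => rfl, ?_⟩,
    ?_, ?_, ?_⟩
  · intro w
    change _ = b w
    split_ifs with h h'
    · have h1 := hbl w; have h2 := hbu w
      rw [h] at h1 h2 ⊢
      linarith
    · have h1 := hbl w; have h2 := hbu w
      rw [h] at h1 h2 ⊢
      linarith
    · field_simp
  · intro w
    simp only
    split_ifs with h h'
    · exact hlu
    · exact le_rfl
    · rw [le_div_iff₀ (lt_of_le_of_ne (hc0 w) (Ne.symm h)), mul_comm]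
      exact hbl w
  · intro w
    simp only
    split_ifs with h h'
    · exact le_rfl
    · exact hlu
    · rw [div_le_iff₀ (lt_of_le_of_ne (hc0 w) (Ne.symm h)), mul_comm]
      exact hbu w
  · simp only [Bool.false_eq_true, if_false, if_true]
    split_ifs with h0 h1 h1
    · exact hlu
    · rw [le_div_iff₀ (lt_of_le_of_ne (hc0 _) (Ne.symm h1)), mul_comm]
      exact hbl _
    · rw [div_le_iff₀ (lt_of_le_of_ne (hc0 _) (Ne.symm h0)), mul_comm]
      exact hbu _
    · rw [div_le_div_iff₀ (lt_of_le_of_ne (hc0 _) (Ne.symm h0))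
        (lt_of_le_of_ne (hc0 _) (Ne.symm h1))]
      linarith

/-! ### The set of report structures -/

lemma mem_ciidReports_of_isVoteProfile {n : ℕ} (hn : 1 ≤ n) {ψ : ℝ → ℝ} (hψ : Measurable ψ)
    (h0 : ∀ p, 0 ≤ ψ p) (h1 : ∀ p, ψ p ≤ 1) (m : ProbabilityMeasure unitInterval)
    {c a : Bool → ℝ} (h : IsVoteProfile ψ m c a) : binomialReport n c a ∈ ciidReports n ψ := by
  obtain ⟨θ, hθ, hm⟩ := exists_isCIID_posteriorLaw_eq (⟨0, hn⟩ : Fin n) m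
  exact ⟨θ, hθ, hθ.rep_eq_binomialReport ⟨0, hn⟩ hψ h0 h1 (by rwa [hm])⟩

lemma exists_isVoteProfile_of_mem_ciidReports {n : ℕ} (hn : 1 ≤ n) {lam : ℝ} (hlam : 0 ≤ lam)
    {r : ReportStructure n} (hr : r ∈ ciidReports n (psi lam)) :
    ∃ (m : ProbabilityMeasure unitInterval) (c a : Bool → ℝ), IsVoteProfile (psi lam) m c a ∧
      (∀ w, psi lam 0 ≤ a w) ∧ (∀ w, a w ≤ psi lam 1) ∧ a false ≤ a true ∧
      r = binomialReport n c a := by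
  obtain ⟨θ, hθ, rfl⟩ := hr
  obtain ⟨c, a, h, hl, hu, ha⟩ := exists_isVoteProfile (θ.posteriorLaw ⟨0, hn⟩)
    (continuous_psi lam).measurable (monotone_psi hlam)
    (fun p hp => monotone_psi hlam hp.1) (fun p hp => monotone_psi hlam hp.2)
  exact ⟨⟨θ.posteriorLaw ⟨0, hn⟩, inferInstance⟩, c, a, h, hl, hu, ha,
    hθ.rep_eq_binomialReport ⟨0, hn⟩ (continuous_psi lam).measurable (fun p => (psi_pos _ _).le)
      (fun p => (psi_lt_one _ _).le) h⟩

lemma ciidReports_nonneg {n : ℕ} (hn : 1 ≤ n) {lam : ℝ} (hlam : 0 ≤ lam)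
    {r : ReportStructure n} (hr : r ∈ ciidReports n (psi lam)) (z : Bool × (Fin n → Bool)) :
    0 ≤ r z := by
  obtain ⟨m, c, a, h, hl, hu, -, rfl⟩ := exists_isVoteProfile_of_mem_ciidReports hn hlam hr
  exact binomialReport_nonneg h.prior_nonneg (fun w => (psi_pos _ _).le.trans (hl w))
    (fun w => (hu w).trans (psi_lt_one _ _).le) z

lemma continuous_binomialReport (n : ℕ) :
    Continuous fun q : (Bool → ℝ) × (Bool → ℝ) => binomialReport n q.1 q.2 := by
  refine continuous_pi fun z => ?_
  unfold binomialReport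
  refine Continuous.mul (by fun_prop) (continuous_finsetProd _ fun i _ => ?_)
  split_ifs <;> fun_prop

/-- Laws on [0,1] form a weakly compact space and ψ is continuous, so the vote profile equations are
closed. Since `a w` is not determined by the law when `c w = 0`, the profile is carried along as an
extra coordinate in a cube. -/
theorem isCompact_ciidReports {n : ℕ} (hn : 1 ≤ n) {lam : ℝ} (hlam : 0 ≤ lam) :
    IsCompact (ciidReports n (psi lam)) := by
  have hint : ∀ g : ℝ → ℝ, Continuous g → Continuous fun m : ProbabilityMeasure unitInterval =>
      ∫ p : unitInterval, g p ∂(m : Measure unitInterval) := by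
    intro g hg
    exact ProbabilityMeasure.continuous_integral_boundedContinuousFunction
      (BoundedContinuousFunction.mkOfCompact ⟨fun p : unitInterval => g p, by fun_prop⟩)
  have hw : ∀ w, Continuous (stateWeight w) := by
    intro w
    cases w
    · exact continuous_const.sub continuous_id
    · exact continuous_id
  let S : Set (ProbabilityMeasure unitInterval × (Bool → ℝ) × (Bool → ℝ)) :=
    (univ ×ˢ (Icc 0 1 ×ˢ Icc 0 1)) ∩ {q | IsVoteProfile (psi lam) q.1 q.2.1 q.2.2}
  have hS : IsCompact S := by
    refine (isCompact_univ.prod (isCompact_Icc.prod isCompact_Icc)).inter_right ?_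
    have : {q : ProbabilityMeasure unitInterval × (Bool → ℝ) × (Bool → ℝ) |
        IsVoteProfile (psi lam) q.1 q.2.1 q.2.2}
        = (⋂ w, {q | q.2.1 w = ∫ p : unitInterval, stateWeight w p ∂(q.1 : Measure _)}) ∩
          ⋂ w, {q | q.2.1 w * q.2.2 w
            = ∫ p : unitInterval, stateWeight w p * psi lam p ∂(q.1 : Measure _)} := by
      ext q
      simp only [mem_ofPred_eq, mem_inter_iff, mem_iInter]
      exact ⟨fun h => ⟨h.1, h.2⟩, fun h => ⟨h.1, h.2⟩⟩
    rw [this]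
    refine (isClosed_iInter fun w => isClosed_eq (by fun_prop) ?_).inter
      (isClosed_iInter fun w => isClosed_eq (by fun_prop) ?_)
    · exact (hint _ (hw w)).comp continuous_fst
    · exact (hint _ ((hw w).mul (continuous_psi lam))).comp continuous_fst
  have himage : ciidReports n (psi lam)
      = (fun q : ProbabilityMeasure unitInterval × (Bool → ℝ) × (Bool → ℝ) =>
          binomialReport n q.2.1 q.2.2) '' S := by
    ext r
    constructor
    · intro hr
      obtain ⟨m, c, a, h, hl, hu, -, rfl⟩ := exists_isVoteProfile_of_mem_ciidReports hn hlam hr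
      refine ⟨(m, c, a), ⟨⟨mem_univ _, ⟨fun w => h.prior_nonneg w, fun w => ?_⟩,
        fun w => (psi_pos _ _).le.trans (hl w), fun w => (hu w).trans (psi_lt_one _ _).le⟩, h⟩, rfl⟩
      have h1 := h.prior_add_prior
      have h2 := h.prior_nonneg true
      have h3 := h.prior_nonneg false
      cases w <;> simp only [Pi.one_apply] <;> linarith
    · rintro ⟨q, ⟨-, hq⟩, rfl⟩
      exact mem_ciidReports_of_isVoteProfile hn (continuous_psi lam).measurable
        (fun p => (psi_pos _ _).le) (fun p => (psi_lt_one _ _).le) q.1 hq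
  rw [himage]
  exact hS.image ((continuous_binomialReport n).comp continuous_snd)

lemma ciidReports_nonempty {n : ℕ} (hn : 1 ≤ n) {lam : ℝ} (hlam : 0 ≤ lam) :
    (ciidReports n (psi lam)).Nonempty := by
  let m : ProbabilityMeasure unitInterval := ⟨Measure.dirac 0, inferInstance⟩
  obtain ⟨c, a, h, -⟩ := exists_isVoteProfile (m : Measure unitInterval)
    (continuous_psi lam).measurable (monotone_psi hlam)
    (fun p hp => monotone_psi hlam hp.1) (fun p hp => monotone_psi hlam hp.2)
  exact ⟨_, mem_ciidReports_of_isVoteProfile hn (continuous_psi lam).measurable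
    (fun p => (psi_pos _ _).le) (fun p => (psi_lt_one _ _).le) m h⟩

theorem isGreatest_worstRegret {n : ℕ} (hn : 1 ≤ n) {lam : ℝ} (hlam : 0 ≤ lam)
    (f : Aggregator n) :
    IsGreatest (regret f '' ciidReports n (psi lam)) (worstRegret n (psi lam) f) :=
  ((isCompact_ciidReports hn hlam).image_of_continuousOn
    ((continuousOn_regret f).mono fun _ hr => ciidReports_nonneg hn hlam hr)).isGreatest_sSup
    ((ciidReports_nonempty hn hlam).image _)

/-! ### A single expert -/

section SingleExpert

variable {ψ : ℝ → ℝ} {m : Measure unitInterval} [IsProbabilityMeasure m] {c a : Bool → ℝ}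

lemma margin_one_of_isVoteProfile (hψ : Measurable ψ) {C : ℝ} (hC : ∀ p, |ψ p| ≤ C)
    (h : IsVoteProfile ψ m c a) :
    margin (binomialReport 1 c a) 1 = ∫ p : unitInterval, (2 * (p : ℝ) - 1) * ψ p ∂m := by
  rw [margin_binomialReport]
  simp only [Nat.choose_self, Nat.cast_one, one_mul, pow_one, Nat.sub_self, pow_zero, mul_one]
  rw [h.vote, h.vote, ← integral_sub (integrable_stateWeight_mul m _ hψ hC)
    (integrable_stateWeight_mul m _ hψ hC)]
  congr 1
  ext p
  simp only [stateWeight, Bool.false_eq_true, if_false, if_true]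
  ring

lemma margin_zero_of_isVoteProfile (hψ : Measurable ψ) {C : ℝ} (hC : ∀ p, |ψ p| ≤ C)
    (h : IsVoteProfile ψ m c a) :
    margin (binomialReport 1 c a) 0
      = ∫ p : unitInterval, (2 * (p : ℝ) - 1) * (1 - ψ p) ∂m := by
  rw [margin_binomialReport]
  simp only [Nat.choose_zero_right, Nat.cast_one, one_mul, pow_one, Nat.sub_zero, pow_zero,
    mul_one, mul_sub]
  have hi := integrable_stateWeight m
  have hj := fun w => integrable_stateWeight_mul m w hψ hC
  have hij : ∀ w, Integrable (fun p : unitInterval => stateWeight w p - stateWeight w p * ψ p) m :=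
    fun w => (hi w).sub (hj w)
  rw [h.vote, h.vote, h.prior, h.prior, ← integral_sub (hi _) (hj _),
    ← integral_sub (hi _) (hj _), ← integral_sub (hij _) (hij _)]
  congr 1
  ext p
  simp only [stateWeight, Bool.false_eq_true, if_false, if_true]
  ring

lemma integrable_two_mul_sub_one_mul (hψ : Measurable ψ) {C : ℝ} (hC : ∀ p, |ψ p| ≤ C) :
    Integrable (fun p : unitInterval => (2 * (p : ℝ) - 1) * ψ p) m := by
  refine integrable_unitInterval m (g := fun p => (2 * p - 1) * ψ p)
    (((measurable_const.mul measurable_id).sub measurable_const).mul hψ) (C := C) fun p => ?_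
  rw [abs_mul]
  refine (mul_le_of_le_one_left (abs_nonneg _) ?_).trans (hC _)
  rw [abs_le]
  constructor <;> linarith [p.2.1, p.2.2]

/-- The two margins are the integrals of (2p - 1)ψ and (2p - 1)(1 - ψ); the triangle inequality
gives the bound. -/
lemma maxUtility_single_le (hψ : Measurable ψ) (h0 : ∀ p, 0 ≤ ψ p) (h1 : ∀ p, ψ p ≤ 1)
    (hr : ∀ z, 0 ≤ binomialReport 1 c a z) (h : IsVoteProfile ψ m c a) :
    maxUtility (binomialReport 1 c a) ≤ ∫ p : unitInterval, |2 * (p : ℝ) - 1| ∂m := by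
  have hC : ∀ p, |ψ p| ≤ 1 := fun p => by rw [abs_of_nonneg (h0 p)]; exact h1 p
  have hC' : ∀ p, |1 - ψ p| ≤ 1 := fun p => by
    rw [abs_of_nonneg (by linarith [h1 p])]; linarith [h0 p]
  have hψ' : Measurable fun p => 1 - ψ p := measurable_const.sub hψ
  rw [maxUtility_eq_sum_abs_margin hr, Fin.sum_univ_two]
  change |margin _ 0| + |margin _ 1| ≤ _
  rw [margin_one_of_isVoteProfile hψ hC h, margin_zero_of_isVoteProfile hψ hC h]
  have i1 := integrable_two_mul_sub_one_mul (m := m) hψ hC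
  have i0 := integrable_two_mul_sub_one_mul (m := m) hψ' hC'
  refine (add_le_add abs_integral_le_integral_abs abs_integral_le_integral_abs).trans ?_
  rw [← integral_add i0.abs i1.abs]
  refine le_of_eq ?_
  congr 1
  ext p
  rw [abs_mul, abs_mul, abs_of_nonneg (h0 p), abs_of_nonneg (sub_nonneg.mpr (h1 p))]
  ring

lemma utility_majority_single_psiInfty (hr : ∀ z, 0 ≤ binomialReport 1 c a z)
    (h : IsVoteProfile psiInfty m c a) :
    utility (majority 1) (binomialReport 1 c a) = ∫ p : unitInterval, |2 * (p : ℝ) - 1| ∂m := by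
  have hC : ∀ p, |psiInfty p| ≤ 1 := fun p => by
    rw [abs_of_nonneg (psiInfty_nonneg p)]; exact psiInfty_le_one p
  have hC' : ∀ p, |1 - psiInfty p| ≤ 1 := fun p => by
    rw [abs_of_nonneg (by linarith [psiInfty_le_one p])]; linarith [psiInfty_nonneg p]
  rw [utility_eq_sum_margin hr, Fin.sum_univ_two, two_mul_majority_sub_one,
    two_mul_majority_sub_one]
  change margin _ 0 * (if 2 * 0 < 1 then -1 else _) + margin _ 1 * (if 2 * 1 < 1 then _ else
    if 2 * 1 = 1 then _ else 1) = _
  norm_num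
  rw [margin_one_of_isVoteProfile measurable_psiInfty hC h,
    margin_zero_of_isVoteProfile measurable_psiInfty hC h, neg_add_eq_sub,
    ← integral_sub (integrable_two_mul_sub_one_mul measurable_psiInfty hC)
      (integrable_two_mul_sub_one_mul (ψ := fun p => 1 - psiInfty p)
        (measurable_const.sub measurable_psiInfty) hC')]
  congr 1
  ext p
  unfold psiInfty
  split_ifs with h1 h2
  · rw [abs_of_pos (by linarith)]; ring
  · rw [h2]; norm_num
  · rw [abs_of_nonpos (by linarith)]; ring

end SingleExpert

theorem single_expert_psiInfty_best {θ : SignalStructure 1} (hθ : θ.IsCIID) {lam : ℝ}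
    (hlam : 0 ≤ lam) :
    maxUtility (rep θ (psi lam)) ≤ utility (majority 1) (rep θ psiInfty) ∧
      utility (majority 1) (rep θ psiInfty) = maxUtility (rep θ psiInfty) := by
  have hmono : Monotone psiInfty := by
    intro p q hpq
    unfold psiInfty
    split_ifs <;> first | linarith | norm_num
    exact absurd (le_antisymm (not_lt.mp ‹¬1 / 2 < q›) (by linarith)) ‹¬q = 1 / 2›
  obtain ⟨c, a, h, hl, hu, -⟩ := exists_isVoteProfile (θ.posteriorLaw 0)
    (continuous_psi lam).measurable (monotone_psi hlam) (fun p _ => (psi_pos lam p).le)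
    (fun p _ => (psi_lt_one lam p).le)
  obtain ⟨c', a', h', hl', hu', -⟩ := exists_isVoteProfile (θ.posteriorLaw 0)
    measurable_psiInfty hmono (fun p _ => psiInfty_nonneg p) (fun p _ => psiInfty_le_one p)
  rw [hθ.rep_eq_binomialReport 0 (continuous_psi lam).measurable (fun p => (psi_pos lam p).le)
      (fun p => (psi_lt_one lam p).le) h,
    hθ.rep_eq_binomialReport 0 measurable_psiInfty psiInfty_nonneg psiInfty_le_one h']
  have hr := binomialReport_nonneg (n := 1) h.prior_nonneg hl hu
  have hr' := binomialReport_nonneg (n := 1) h'.prior_nonneg hl' hu'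
  have e := utility_majority_single_psiInfty hr' h'
  rw [e]
  refine ⟨maxUtility_single_le (continuous_psi lam).measurable (fun p => (psi_pos lam p).le)
      (fun p => (psi_lt_one lam p).le) hr h, le_antisymm ?_
      (maxUtility_single_le measurable_psiInfty psiInfty_nonneg psiInfty_le_one hr' h')⟩
  rw [← e]
  exact (isGreatest_maxUtility _).2 ⟨_, rfl⟩

/-! ### Bounded rationality advantage -/

lemma maxUtility_unanimous {n : ℕ} {c : Bool → ℝ} (hc : ∀ w, 0 ≤ c w)
    (h : c false ≤ c true) :
    maxUtility (binomialReport n c fun _ => 1) = c true - c false := by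
  rw [maxUtility_eq_sum_abs_margin (binomialReport_nonneg hc (by simp) (by simp)),
    ← sum_margin_binomialReport n c fun _ => 1]
  refine Finset.sum_congr rfl fun x _ => abs_of_nonneg ?_
  rw [margin_binomialReport]
  have h0 : (0 : ℝ) ≤ (1 - 1) ^ (n - (x : ℕ)) := by simp
  have h1 : (0 : ℝ) ≤ (1 : ℝ) ^ (x : ℕ) * (1 - 1) ^ (n - (x : ℕ)) := by simp
  exact mul_nonneg (by positivity) (by nlinarith)

/-- One negative margin, here at zero votes, makes the sum of absolute margins exceed the sum of
margins. -/
lemma lt_maxUtility_of_margin_zero_neg {n : ℕ} {c a : Bool → ℝ} (hc : ∀ w, 0 ≤ c w)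
    (h0 : ∀ w, 0 ≤ a w) (h1 : ∀ w, a w ≤ 1)
    (h : c true * (1 - a true) ^ n < c false * (1 - a false) ^ n) :
    c true - c false < maxUtility (binomialReport n c a) := by
  rw [maxUtility_eq_sum_abs_margin (binomialReport_nonneg hc h0 h1),
    ← sum_margin_binomialReport n c a]
  refine Finset.sum_lt_sum (fun x _ => le_abs_self _) ⟨0, Finset.mem_univ _, ?_⟩
  have hneg : margin (binomialReport n c a) ((0 : Fin (n + 1)) : ℕ) < 0 := by
    rw [margin_binomialReport]
    simpa using h
  exact hneg.trans_le (abs_nonneg _)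

/-- Compared with always guessing 1, majority voting loses only at x ≤ n/2. There at least two
experts vote 0 because n > 2, so the loss in the state 1 is at most a multiple of (1 - a true)²,
with binomial coefficients adding up to at most 2^n. The gain in the state 0 at x = 0 alone
outweighs it. -/
lemma lt_utility_majority {n : ℕ} (hn : 2 < n) {c a : Bool → ℝ} (hc : ∀ w, 0 ≤ c w)
    (h0 : ∀ w, 0 ≤ a w) (h1 : ∀ w, a w ≤ 1)
    (h : c true * (1 - a true) ^ 2 * 2 ^ n < c false * (1 - a false) ^ n) :
    c true - c false < utility (majority n) (binomialReport n c a) := by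
  rw [utility_eq_sum_margin (binomialReport_nonneg hc h0 h1), ← sum_margin_binomialReport n c a,
    ← sub_neg, ← Finset.sum_sub_distrib]
  have hterm : ∀ x : Fin (n + 1), margin (binomialReport n c a) x
      - margin (binomialReport n c a) x * (2 * (majority n x : ℝ) - 1)
      ≤ 2 * (c true * (1 - a true) ^ 2) * n.choose x
        - if x = 0 then 2 * (c false * (1 - a false) ^ n) else 0 := by
    intro x
    have hb1 : 0 ≤ 1 - a true := by linarith [h1 true]
    have hb0 : 0 ≤ 1 - a false := by linarith [h1 false]
    have hpow : 2 * (x : ℕ) ≤ n → a true ^ (x : ℕ) * (1 - a true) ^ (n - (x : ℕ))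
        ≤ (1 - a true) ^ 2 := by
      intro hx
      calc a true ^ (x : ℕ) * (1 - a true) ^ (n - (x : ℕ))
          ≤ 1 * (1 - a true) ^ (n - (x : ℕ)) :=
            mul_le_mul_of_nonneg_right (pow_le_one₀ (h0 _) (h1 _)) (by positivity)
        _ ≤ (1 - a true) ^ 2 := by
            rw [one_mul]
            exact pow_le_pow_of_le_one hb1 (by linarith [h0 true]) (by omega)
    have hC : (0 : ℝ) ≤ n.choose x := by positivity
    have hq : 0 ≤ c true * (1 - a true) ^ 2 := mul_nonneg (hc _) (by positivity)
    have ha0 := h0 false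
    have hf : 0 ≤ c false * (a false ^ (x : ℕ) * (1 - a false) ^ (n - (x : ℕ))) :=
      mul_nonneg (hc _) (by positivity)
    have hup : 2 * (x : ℕ) ≤ n → margin (binomialReport n c a) x
        ≤ (c true * (1 - a true) ^ 2) * n.choose x := by
      intro hx
      rw [margin_binomialReport, mul_comm]
      refine mul_le_mul_of_nonneg_right ?_ hC
      linarith [mul_le_mul_of_nonneg_left (hpow hx) (hc true)]
    rw [two_mul_majority_sub_one]
    by_cases hx0 : x = 0
    · subst hx0
      have hm := hpow (by simp)
      have := mul_le_mul_of_nonneg_left hm (hc true)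
      rw [margin_binomialReport, if_pos (by simp; omega)]
      simp only [Fin.val_zero, Nat.choose_zero_right, Nat.cast_one, pow_zero, one_mul, Nat.sub_zero,
        if_true, mul_one] at this ⊢
      linarith
    · rw [if_neg hx0]
      have hp := mul_nonneg hq hC
      split_ifs with h2 h3
      · linarith [hup (by omega)]
      · linarith [hup (by omega)]
      · linarith
  refine (Finset.sum_le_sum fun x _ => hterm x).trans_lt ?_
  rw [Finset.sum_sub_distrib, ← Finset.mul_sum, Finset.sum_ite_eq' Finset.univ (0 : Fin (n + 1)),
    if_pos (Finset.mem_univ _), Fin.sum_univ_eq_sum_range (fun x => (n.choose x : ℝ))]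
  have : ∑ x ∈ Finset.range (n + 1), (n.choose x : ℝ) = 2 ^ n := by
    exact_mod_cast Nat.sum_range_choose n
  rw [this]
  linarith

/-- The law of the posterior that is `p` with probability `t`, and otherwise `1`. -/
def twoPointLaw (t p : unitInterval) : Measure unitInterval :=
  ENNReal.ofReal t • Measure.dirac p + ENNReal.ofReal (1 - t) • Measure.dirac 1

lemma integral_twoPointLaw (t p : unitInterval) (g : unitInterval → ℝ) :
    ∫ q, g q ∂(twoPointLaw t p) = t * g p + (1 - t) * g 1 := by
  unfold twoPointLaw
  rw [integral_add_measure, integral_smul_measure, integral_smul_measure, integral_dirac,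
    integral_dirac, ENNReal.toReal_ofReal t.2.1, ENNReal.toReal_ofReal (by linarith [t.2.2])]
  · rfl
  · exact (integrable_dirac (by simp)).smul_measure (by simp)
  · exact (integrable_dirac (by simp)).smul_measure (by simp)

instance (t p : unitInterval) : IsProbabilityMeasure (twoPointLaw t p) := by
  constructor
  unfold twoPointLaw
  simp only [Measure.add_apply, Measure.smul_apply, measure_univ, smul_eq_mul, mul_one]
  rw [← ENNReal.ofReal_add t.2.1 (by linarith [t.2.2])]
  simp

/-- Parameters of a two-point law of the posterior for which bounded rationality helps: experts who
are almost certain of the state `1` vote `1` more often than the others, while a fixed fraction of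
the votes of the others is `0`. -/
lemma exists_advantage_parameters (n : ℕ) :
    ∃ (lam p t a₁ : ℝ), 0 ≤ lam ∧ 1 / 2 < p ∧ p ≤ 1 ∧ 0 ≤ t ∧ t ≤ 1 ∧ 0 ≤ a₁ ∧ a₁ ≤ 1 ∧
      psi lam p = 3 / 4 ∧ (t * p + (1 - t)) * a₁ = t * p * (3 / 4) + (1 - t) * psi lam 1 ∧
      t * (1 - p) ≤ t * p + (1 - t) ∧
      (t * p + (1 - t)) * (1 - a₁) ^ 2 * 2 ^ n < t * (1 - p) * (1 - 3 / 4) ^ n := by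
  -- `M` is the odds of a vote 1 at posterior 1. The factor 8^n pays for 2^n and for (1/4)^n, and 32
  -- exceeds the constant 4 coming from (1 - a₁)² ≤ (2/M)².
  obtain ⟨M, hM⟩ : ∃ M : ℝ, M = 32 * 8 ^ n := ⟨_, rfl⟩
  have hM9 : 9 ≤ M := by
    have : (1 : ℝ) ≤ 8 ^ n := one_le_pow₀ (by norm_num)
    linarith
  have hlog3 : 0 < Real.log 3 := Real.log_pos (by norm_num)
  have hlogM : 2 * Real.log 3 ≤ Real.log M := by
    have h : Real.log 9 = 2 * Real.log 3 := by
      rw [show (9 : ℝ) = 3 ^ 2 by norm_num, Real.log_pow]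
      norm_num
    rw [← h]
    exact Real.log_le_log (by norm_num) hM9
  have hlogM0 : 0 < Real.log M := by linarith
  -- With λ = log M / 2, this solves 2λ(2p - 1) = log 3, so that the odds of a vote 1 at `p` are 3.
  obtain ⟨p, hp⟩ : ∃ p : ℝ, p = 1 / 2 + Real.log 3 / (2 * Real.log M) := ⟨_, rfl⟩
  have hp1 : 1 / 2 < p := by
    rw [hp]
    have : 0 < Real.log 3 / (2 * Real.log M) := by positivity
    linarith
  have hp2 : p ≤ 3 / 4 := by
    have : Real.log 3 / (2 * Real.log M) ≤ 1 / 4 := by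
      rw [div_le_iff₀ (by positivity)]
      linarith
    linarith
  obtain ⟨lam, hlam⟩ : ∃ lam : ℝ, lam = Real.log M / 2 := ⟨_, rfl⟩
  have hpsi1 : psi lam 1 = M / (1 + M) := by
    rw [psi_eq, hlam, show -(2 * (Real.log M / 2) * (2 * 1 - 1)) = -Real.log M by ring,
      Real.exp_neg, Real.exp_log (by linarith)]
    field_simp
    ring
  have hpsip : psi lam p = 3 / 4 := by
    rw [psi_eq, hlam, hp, show -(2 * (Real.log M / 2) *
      (2 * (1 / 2 + Real.log 3 / (2 * Real.log M)) - 1)) = -Real.log 3 by field_simp; ring,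
      Real.exp_neg, Real.exp_log (by norm_num)]
    norm_num
  -- Chosen so that the state 0 has probability 1 / (1 + M); the prior of the state 1 then equals
  -- ψ(1).
  obtain ⟨t, ht⟩ : ∃ t : ℝ, t = 1 / ((1 + M) * (1 - p)) := ⟨_, rfl⟩
  have h1p : 0 < 1 - p := by linarith
  have h1M : 0 < 1 + M := by linarith
  have ht0 : 0 ≤ t := by rw [ht]; positivity
  have ht1 : t ≤ 1 := by
    rw [ht, div_le_one (by positivity)]
    nlinarith
  have htp : t * (1 - p) = 1 / (1 + M) := by rw [ht]; field_simp
  obtain ⟨c0, hc0⟩ : ∃ c0 : ℝ, c0 = 1 / (1 + M) := ⟨_, rfl⟩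
  obtain ⟨c1, hc1⟩ : ∃ c1 : ℝ, c1 = M / (1 + M) := ⟨_, rfl⟩
  have hc0pos : 0 < c0 := by rw [hc0]; positivity
  have hc1pos : 0 < c1 := by rw [hc1]; exact div_pos (by linarith) h1M
  have hc10 : c1 = M * c0 := by rw [hc1, hc0]; ring
  have hc01 : c0 + c1 = 1 := by rw [hc0, hc1]; field_simp
  obtain ⟨a1, ha1⟩ : ∃ a1 : ℝ, a1 = (t * p * (3 / 4) + (1 - t) * c1) / c1 := ⟨_, rfl⟩
  have ha1' : c1 * a1 = t * p * (3 / 4) + (1 - t) * c1 := by rw [ha1]; field_simp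
  have htc : t = t * p + c0 := by rw [hc0, ← htp]; ring
  have hgap : c1 * (1 - a1) ≤ 2 * c0 := by
    have e : t * p ≤ 3 * c0 := by
      have : t * (3 - 4 * p) ≥ 0 := mul_nonneg ht0 (by linarith)
      linarith
    have e2 : c1 * (1 - a1) = t * p / 4 + (1 - t) * (1 - c1) := by
      have : c1 * (1 - a1) = c1 - c1 * a1 := by ring
      rw [this, ha1', show c1 = 1 - c0 by linarith]
      linear_combination htc
    rw [e2]
    nlinarith
  have ha10 : 0 ≤ a1 := by
    rw [ha1]
    refine div_nonneg (add_nonneg ?_ ?_) hc1pos.le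
    · nlinarith [mul_nonneg ht0 (show 0 ≤ p by linarith)]
    · exact mul_nonneg (by linarith) hc1pos.le
  have ha11 : a1 ≤ 1 := by
    rw [ha1, div_le_one hc1pos]
    nlinarith [mul_nonneg ht0 (show 0 ≤ p by linarith)]
  have hkey : c1 * (1 - a1) ^ 2 * 2 ^ n < c0 * (1 - 3 / 4) ^ n := by
    have hg0 : 0 ≤ 1 - a1 := by linarith
    have e1 : M * (1 - a1) ≤ 2 := by
      rw [hc10] at hgap
      nlinarith
    have e2 : M * (c1 * (1 - a1) ^ 2) ≤ 4 * c0 := by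
      have : M * (c1 * (1 - a1) ^ 2) = (M * (1 - a1)) * (c1 * (1 - a1)) := by ring
      rw [this]
      have h3 : 0 ≤ c1 * (1 - a1) := by positivity
      nlinarith
    have e3 : (2 : ℝ) ^ n * 4 ^ n = 8 ^ n := by rw [← mul_pow]; norm_num
    have e4 : ((1 : ℝ) - 3 / 4) ^ n * 4 ^ n = 1 := by rw [← mul_pow]; norm_num
    have h4 : (0 : ℝ) < 4 ^ n := by positivity
    rw [← mul_lt_mul_iff_left₀ h4]
    calc c1 * (1 - a1) ^ 2 * 2 ^ n * 4 ^ n = M * (c1 * (1 - a1) ^ 2) / 32 := by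
          rw [mul_assoc, e3, hM]; ring
      _ < c0 := by linarith
      _ = c0 * (1 - 3 / 4) ^ n * 4 ^ n := by rw [mul_assoc, e4, mul_one]
  have hc1' : t * p + (1 - t) = c1 := by linarith
  have hc0' : t * (1 - p) = c0 := by rw [htp, hc0]
  refine ⟨lam, p, t, a1, by rw [hlam]; positivity, hp1, by linarith, ht0, ht1, ha10, ha11, hpsip,
    ?_, ?_, ?_⟩
  · rw [hc1', hpsi1, ← hc1, ha1']
  · rw [hc1', hc0']; nlinarith
  · rw [hc1', hc0']; exact hkey

theorem exists_bounded_rationality_advantage {n : ℕ} (hn : 2 ≤ n) :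
    ∃ θ : SignalStructure n, θ.IsCIID ∧ ∃ lam : ℝ, 0 ≤ lam ∧
      maxUtility (rep θ psiInfty) < maxUtility (rep θ (psi lam)) ∧
      (2 < n → maxUtility (rep θ psiInfty) < utility (majority n) (rep θ (psi lam))) := by
  obtain ⟨lam, p, t, a₁, hlam, hp, hp1, ht0, ht1, ha0, ha1, hpsi, hvote, hle, hkey⟩ :=
    exists_advantage_parameters n
  let T : unitInterval := ⟨t, ht0, ht1⟩
  let P : unitInterval := ⟨p, by linarith, hp1⟩
  have hn0 : 0 < n := by omega
  obtain ⟨θ, hθ, hθm⟩ := exists_isCIID_posteriorLaw_eq (⟨0, hn0⟩ : Fin n)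
    ⟨twoPointLaw T P, inferInstance⟩
  rw [ProbabilityMeasure.coe_mk] at hθm
  let c : Bool → ℝ := fun w => if w then t * p + (1 - t) else t * (1 - p)
  let a : Bool → ℝ := fun w => if w then a₁ else 3 / 4
  have hinf : psiInfty p = 1 := by unfold psiInfty; rw [if_pos hp]
  have hinf1 : psiInfty 1 = 1 := by unfold psiInfty; norm_num
  have hprior : ∀ w, c w = ∫ q : unitInterval, stateWeight w q ∂(twoPointLaw T P) := by
    intro w
    rw [integral_twoPointLaw T P fun q => stateWeight w q]
    cases w <;> simp [c, stateWeight, T, P]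
  have hprof : IsVoteProfile (psi lam) (twoPointLaw T P) c a := by
    refine ⟨hprior, fun w => ?_⟩
    rw [integral_twoPointLaw T P fun q => stateWeight w q * psi lam q]
    cases w
    · simp only [c, a, stateWeight, Bool.false_eq_true, if_false, T, P, Set.Icc.coe_one, hpsi]
      ring
    · simp only [c, a, stateWeight, if_true, T, P, Set.Icc.coe_one, hpsi]
      linarith
  have hprof' : IsVoteProfile psiInfty (twoPointLaw T P) c fun _ => 1 := by
    refine ⟨hprior, fun w => ?_⟩
    rw [mul_one, hprior, integral_twoPointLaw T P fun q => stateWeight w q,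
      integral_twoPointLaw T P fun q => stateWeight w q * psiInfty q]
    simp only [T, P, Set.Icc.coe_one, hinf, hinf1, mul_one]
  have h0 : ∀ w, 0 ≤ a w := by
    intro w
    cases w
    · norm_num [a]
    · simpa [a] using ha0
  have h1 : ∀ w, a w ≤ 1 := by
    intro w
    cases w
    · norm_num [a]
    · simpa [a] using ha1
  have hc := hprof.prior_nonneg
  rw [← hθm] at hprof hprof'
  refine ⟨θ, hθ, lam, hlam, ?_⟩
  rw [hθ.rep_eq_binomialReport ⟨0, hn0⟩ (continuous_psi lam).measurable
      (fun p => (psi_pos lam p).le) (fun p => (psi_lt_one lam p).le) hprof,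
    hθ.rep_eq_binomialReport ⟨0, hn0⟩ measurable_psiInfty psiInfty_nonneg psiInfty_le_one hprof',
    maxUtility_unanimous hc hle]
  refine ⟨lt_maxUtility_of_margin_zero_neg hc h0 h1 (lt_of_le_of_lt ?_ hkey),
    fun hn' => lt_utility_majority hn' hc h0 h1 hkey⟩
  have e1 : (1 - a₁) ^ n ≤ (1 - a₁) ^ 2 :=
    pow_le_pow_of_le_one (by linarith) (by linarith) hn
  have hc1 : 0 ≤ t * p + (1 - t) := hc true
  calc (t * p + (1 - t)) * (1 - a₁) ^ n
      ≤ (t * p + (1 - t)) * (1 - a₁) ^ 2 := mul_le_mul_of_nonneg_left e1 hc1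
    _ ≤ _ := le_mul_of_one_le_right (by positivity) (one_le_pow₀ (by norm_num))

/-! ### Concavity of the logarithmic mean -/

lemma two_mul_sub_one_div_add_one_le_log {r : ℝ} (hr : 1 ≤ r) :
    2 * (r - 1) / (r + 1) ≤ Real.log r := by
  have hd : ∀ x ∈ Ioi (0 : ℝ), HasDerivAt (fun x => Real.log x - 2 * (x - 1) / (x + 1))
      ((x - 1) ^ 2 / (x * (x + 1) ^ 2)) x := by
    intro x hx
    have hx0 : x ≠ 0 := ne_of_gt hx
    have hx1 : x + 1 ≠ 0 := by have : 0 < x := hx; positivity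
    have h := (Real.hasDerivAt_log hx0).sub
      ((((hasDerivAt_id x).sub_const 1).const_mul 2).div ((hasDerivAt_id x).add_const 1) hx1)
    refine h.congr_deriv ?_
    simp only [id]
    field_simp
    ring
  have hmono : MonotoneOn (fun x => Real.log x - 2 * (x - 1) / (x + 1)) (Ioi 0) := by
    refine monotoneOn_of_deriv_nonneg (convex_Ioi 0)
      (fun x hx => (hd x hx).continuousAt.continuousWithinAt)
      (fun x hx => (hd x (interior_subset hx)).differentiableAt.differentiableWithinAt) ?_
    intro x hx
    have hx' : 0 < x := interior_subset hx
    rw [(hd x hx').deriv]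
    positivity
  have := hmono (show (1 : ℝ) ∈ Ioi 0 by simp) (show r ∈ Ioi (0 : ℝ) from by
    have : 0 < r := by linarith
    exact this) hr
  simp at this
  linarith

/-- The log-odds of `q`. -/
def logOdds (q : ℝ) : ℝ := Real.log q - Real.log (1 - q)

lemma hasDerivAt_logOdds {q : ℝ} (h0 : 0 < q) (h1 : q < 1) :
    HasDerivAt logOdds (1 / (q * (1 - q))) q := by
  have h1' : (1 - q) ≠ 0 := by linarith
  have h := (Real.hasDerivAt_log h0.ne').sub
    (HasDerivAt.log ((hasDerivAt_id q).const_sub 1) h1')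
  refine h.congr_deriv ?_
  simp only [id]
  field_simp
  ring

/-- The bound 2(r - 1)/(r + 1) ≤ log r at the odds ratio r of `Q` to `q`; it is precisely the sign
of the second derivative in `concaveOn_sub_div_logOdds_sub`. -/
lemma logOdds_sub_ge {q Q : ℝ} (h0 : 0 < q) (hq : q ≤ Q) (h1 : Q < 1) :
    2 * (Q - q) ≤ (logOdds Q - logOdds q) * (q * (1 - Q) + Q * (1 - q)) := by
  have hQ0 : 0 < Q := by linarith
  have hQ1 : 0 < 1 - Q := by linarith
  have hq1 : 0 < 1 - q := by linarith
  have hr : 1 ≤ Q * (1 - q) / (q * (1 - Q)) := by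
    rw [le_div_iff₀ (by positivity)]
    nlinarith
  have h := two_mul_sub_one_div_add_one_le_log hr
  have e : Real.log (Q * (1 - q) / (q * (1 - Q))) = logOdds Q - logOdds q := by
    rw [Real.log_div (by positivity) (by positivity), Real.log_mul hQ0.ne' hq1.ne',
      Real.log_mul h0.ne' hQ1.ne']
    unfold logOdds
    ring
  rw [e, div_le_iff₀ (by linarith)] at h
  have hp : 0 < q * (1 - Q) := by positivity
  have h2 := mul_le_mul_of_nonneg_right h hp.le
  have e1 : 2 * (Q * (1 - q) / (q * (1 - Q)) - 1) * (q * (1 - Q)) = 2 * (Q - q) := by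
    field_simp; ring
  have e2 : (logOdds Q - logOdds q) * (Q * (1 - q) / (q * (1 - Q)) + 1) * (q * (1 - Q))
      = (logOdds Q - logOdds q) * (q * (1 - Q) + Q * (1 - q)) := by
    field_simp; ring
  rwa [e1, e2] at h2

lemma logOdds_lt {q Q : ℝ} (h0 : 0 < q) (hq : q < Q) (h1 : Q < 1) : logOdds q < logOdds Q := by
  unfold logOdds
  have := Real.log_lt_log h0 hq
  have := Real.log_lt_log (show 0 < 1 - Q by linarith) (show 1 - Q < 1 - q by linarith)
  linarith

lemma concaveOn_sub_div_logOdds_sub {Q : ℝ} (h1 : Q < 1) :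
    ConcaveOn ℝ (Ioo 0 Q) fun q => (Q - q) / (logOdds Q - logOdds q) := by
  have hB : ∀ q ∈ Ioo 0 Q, 0 < logOdds Q - logOdds q := fun q hq =>
    sub_pos.mpr (logOdds_lt hq.1 hq.2 h1)
  have hd1 : ∀ q ∈ Ioo 0 Q, HasDerivAt (fun q => (Q - q) / (logOdds Q - logOdds q))
      ((-(logOdds Q - logOdds q) + (Q - q) * (1 / (q * (1 - q)))) / (logOdds Q - logOdds q) ^ 2)
      q := by
    intro q hq
    have h := ((hasDerivAt_id q).const_sub Q).div
      ((hasDerivAt_logOdds hq.1 (hq.2.trans h1)).const_sub (logOdds Q)) (hB q hq).ne'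
    refine h.congr_deriv ?_
    simp only [id]
    congr 1
    ring
  have hd2 : ∀ q ∈ Ioo 0 Q, HasDerivAt
      (fun q => (-(logOdds Q - logOdds q) + (Q - q) * (1 / (q * (1 - q))))
        / (logOdds Q - logOdds q) ^ 2)
      ((2 * (Q - q) - (logOdds Q - logOdds q) * (q * (1 - Q) + Q * (1 - q)))
        / ((q * (1 - q)) ^ 2 * (logOdds Q - logOdds q) ^ 3)) q := by
    intro q hq
    have hq1 : 0 < 1 - q := by linarith [hq.2]
    have hq0 : 0 < q := hq.1
    have hqq : q * (1 - q) ≠ 0 := by positivity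
    have hb := (hasDerivAt_logOdds hq.1 (hq.2.trans h1)).const_sub (logOdds Q)
    have hi := (((hasDerivAt_id q).mul ((hasDerivAt_id q).const_sub 1)).inv
      (show (id q * (1 - id q)) ≠ 0 from hqq))
    have h := (hb.neg.add (((hasDerivAt_id q).const_sub Q).mul hi)).div (hb.pow 2)
      (pow_ne_zero 2 (hB q hq).ne')
    have hB0 := (hB q hq).ne'
    refine (h.congr_deriv ?_).congr_of_eventuallyEq (Filter.Eventually.of_forall fun x => ?_)
    · simp only [id, Pi.mul_apply, Pi.neg_apply, Pi.add_apply, Pi.inv_apply, Pi.pow_apply]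
      generalize logOdds Q - logOdds q = B at hB0
      field_simp
      ring
    · simp [one_div]
  refine concaveOn_of_hasDerivWithinAt2_nonpos (convex_Ioo 0 Q)
    (f' := fun q => (-(logOdds Q - logOdds q) + (Q - q) * (1 / (q * (1 - q))))
        / (logOdds Q - logOdds q) ^ 2)
    (f'' := fun q => (2 * (Q - q) - (logOdds Q - logOdds q) * (q * (1 - Q) + Q * (1 - q)))
        / ((q * (1 - q)) ^ 2 * (logOdds Q - logOdds q) ^ 3))
    (fun q hq => (hd1 q hq).continuousAt.continuousWithinAt)
    (fun q hq => (hd1 q (interior_subset hq)).hasDerivWithinAt)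
    (fun q hq => (hd2 q (interior_subset hq)).hasDerivWithinAt) ?_
  intro q hq
  have hq' := interior_subset hq
  have := hB q hq'
  have h2 := logOdds_sub_ge hq'.1 hq'.2.le h1
  exact div_nonpos_of_nonpos_of_nonneg (by linarith) (by positivity)

lemma exists_supergradient {s : Set ℝ} {f : ℝ → ℝ} (hf : ConcaveOn ℝ s f) (hs : IsOpen s) {x : ℝ}
    (hx : x ∈ s) : ∃ d : ℝ, ∀ y ∈ s, f y ≤ f x + d * (y - x) := by
  have hx' : x ∈ interior s := by rwa [hs.interior_eq]
  have hg : ConvexOn ℝ s (-f) := hf.neg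
  refine ⟨-derivWithin (-f) (Ioi x) x, fun y hy => ?_⟩
  rcases lt_trichotomy y x with h | rfl | h
  · have h1 := hg.slope_le_leftDeriv_of_mem_interior hy hx' h
    have h2 := hg.leftDeriv_le_rightDeriv_of_mem_interior hx'
    have h3 := h1.trans h2
    rw [slope_def_field, div_le_iff₀ (by linarith)] at h3
    simp only [Pi.neg_apply] at h3
    linarith
  · simp
  · have h1 := hg.rightDeriv_le_slope_of_mem_interior hx' hy h
    rw [slope_def_field, le_div_iff₀ (by linarith)] at h1
    simp only [Pi.neg_apply] at h1
    linarith

/-! ### The prior in terms of the vote probabilities -/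

lemma logOdds_psi (lam p : ℝ) : logOdds (psi lam p) = 2 * lam * (2 * p - 1) := by
  unfold logOdds
  rw [← psi_one_sub, psi_eq, psi_eq, Real.log_inv, Real.log_inv]
  have h := Real.exp_pos (2 * lam * (2 * p - 1))
  have e : 1 + Real.exp (-(2 * lam * (2 * (1 - p) - 1)))
      = Real.exp (2 * lam * (2 * p - 1)) * (1 + Real.exp (-(2 * lam * (2 * p - 1)))) := by
    rw [mul_add, ← Real.exp_add, show -(2 * lam * (2 * (1 - p) - 1)) = 2 * lam * (2 * p - 1) by ring]
    simp [add_comm]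
  rw [e, Real.log_mul h.ne' (by positivity), Real.log_exp]
  ring

lemma eq_of_logOdds_eq {q Q : ℝ} (h0 : 0 < q) (h1 : q < 1) (H0 : 0 < Q) (H1 : Q < 1)
    (h : logOdds q = logOdds Q) : q = Q := by
  rcases lt_trichotomy q Q with h' | h' | h'
  · exact absurd h (logOdds_lt h0 h' H1).ne
  · exact h'
  · exact absurd h (logOdds_lt H0 h' h1).ne'

lemma psi_lt_psi_one {lam p : ℝ} (hlam : 0 < lam) (hp : p < 1) : psi lam p < psi lam 1 := by
  refine lt_of_le_of_ne (monotone_psi hlam.le hp.le) fun h => ?_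
  have := congrArg logOdds h
  rw [logOdds_psi, logOdds_psi] at this
  nlinarith

/-- Since logit ψ(1) - logit ψ(p) = 4λ(1 - p), concavity of the logarithmic mean bounds (ψ(1) -
ψ(p))/(1 - p) by an affine function of ψ(p). The result is a pointwise inequality, with weights `p`
and `1 - p`, ready to be integrated over the posterior. -/
lemma exists_tangent_psi {lam : ℝ} (hlam : 0 < lam) {p₀ : ℝ} (hp₀ : p₀ < 1) :
    ∃ s : ℝ, ∀ p ≤ 1, p * (psi lam 1 - psi lam p) ≤
      (1 - p) * ((psi lam 1 - psi lam p₀) * (p₀ / (1 - p₀)) + s * (psi lam p - psi lam p₀)) := by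
  obtain ⟨d, hd⟩ := exists_supergradient (concaveOn_sub_div_logOdds_sub (psi_lt_one lam 1))
    isOpen_Ioo ⟨psi_pos lam p₀, psi_lt_psi_one hlam hp₀⟩
  have hden : ∀ p, logOdds (psi lam 1) - logOdds (psi lam p) = 4 * lam * (1 - p) := by
    intro p
    rw [logOdds_psi, logOdds_psi]
    ring
  -- The summand 1 comes from subtracting (1 - p)(ψ(1) - ψ(p)) to turn the weight 1 on the left into
  -- `p`.
  refine ⟨4 * lam * d + 1, fun p hp => ?_⟩
  rcases hp.eq_or_lt with rfl | hp
  · simp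
  have h := hd (psi lam p) ⟨psi_pos lam p, psi_lt_psi_one hlam hp⟩
  simp only [hden] at h
  have h1 : 0 < 1 - p := by linarith
  have h2 : 0 < 1 - p₀ := by linarith
  have h3 := mul_le_mul_of_nonneg_left h (show 0 ≤ 4 * lam * (1 - p) by positivity)
  have e1 : 4 * lam * (1 - p) * ((psi lam 1 - psi lam p) / (4 * lam * (1 - p)))
      = psi lam 1 - psi lam p := by field_simp
  have e2 : 4 * lam * (1 - p) * ((psi lam 1 - psi lam p₀) / (4 * lam * (1 - p₀))
      + d * (psi lam p - psi lam p₀))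
      = (1 - p) * ((psi lam 1 - psi lam p₀) * (p₀ / (1 - p₀)) + (psi lam 1 - psi lam p₀)
        + 4 * lam * d * (psi lam p - psi lam p₀)) := by
    field_simp
    ring
  rw [e1, e2] at h3
  linarith

/-- Among the signal structures with given vote probabilities, the prior of the state `1` is largest
if the experts have the posterior `p₀` in the state `0`, and the posterior `p₀` or `1` in the
state `1`. -/
lemma IsVoteProfile.prior_mul_le {lam : ℝ} (hlam : 0 < lam) {m : Measure unitInterval}
    [IsProbabilityMeasure m] {c a : Bool → ℝ} (h : IsVoteProfile (psi lam) m c a) {p₀ : ℝ}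
    (hp₀ : p₀ < 1) (ha : a false = psi lam p₀) :
    c true * (psi lam 1 - a true) ≤ c false * ((psi lam 1 - a false) * (p₀ / (1 - p₀))) := by
  obtain ⟨s, hs⟩ := exists_tangent_psi hlam hp₀
  have hC : ∀ p, |psi lam p| ≤ 1 := fun p => by
    rw [abs_of_pos (psi_pos lam p)]; exact (psi_lt_one lam p).le
  have hi := integrable_stateWeight m
  have hj := fun w => integrable_stateWeight_mul m w (continuous_psi lam).measurable hC
  set K := (psi lam 1 - psi lam p₀) * (p₀ / (1 - p₀)) with hK
  have k1 : Integrable (fun p : unitInterval =>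
      psi lam 1 * stateWeight true p - stateWeight true p * psi lam p) m :=
    ((hi true).const_mul _).sub (hj true)
  have k0 : Integrable (fun p : unitInterval => (K - s * psi lam p₀) * stateWeight false p
      + s * (stateWeight false p * psi lam p)) m :=
    ((hi false).const_mul _).add ((hj false).const_mul _)
  have hle := integral_mono k1 k0 fun p => by
    have := hs p p.2.2
    simp only [stateWeight, Bool.false_eq_true, if_false, if_true]
    linarith
  rw [integral_sub ((hi true).const_mul _) (hj true),
    integral_add ((hi false).const_mul _) ((hj false).const_mul _), integral_const_mul,
    integral_const_mul, integral_const_mul, ← h.prior, ← h.prior, ← h.vote, ← h.vote, ha] at hle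
  rw [ha]
  linarith

/-! ### The threshold set is an interval that contains its supremum -/

/-- This is z/2 ≤ sinh(z/2), squared. -/
lemma sq_mul_exp_le {z : ℝ} (hz : 0 ≤ z) : z ^ 2 * Real.exp z ≤ (Real.exp z - 1) ^ 2 := by
  have h1 : z / 2 ≤ Real.sinh (z / 2) := Real.self_le_sinh_iff.mpr (by linarith)
  rw [Real.sinh_eq] at h1
  have e1 : Real.exp z = Real.exp (z / 2) * Real.exp (z / 2) := by
    rw [← Real.exp_add]; ring_nf
  have e2 : Real.exp (z / 2) * Real.exp (-(z / 2)) = 1 := by rw [← Real.exp_add]; simp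
  have hp := Real.exp_pos (z / 2)
  have h2 : z * Real.exp (z / 2) ≤ Real.exp z - 1 := by
    rw [e1]; nlinarith
  calc z ^ 2 * Real.exp z = (z * Real.exp (z / 2)) ^ 2 := by rw [e1]; ring
    _ ≤ _ := pow_le_pow_left₀ (by positivity) h2 2

/-- With z = 2λ, T = 1 - 2q₀ and L = -logit q₀, this is the λ-dependent quotient of the threshold
inequality at q₁ = 1/2. The decrease of the hyperbolic cotangent is outweighed by the growth of the
other factor, thanks to `sq_mul_exp_le` and T ≤ L. -/
lemma monotoneOn_one_add_mul_div {T L : ℝ} (hT : 0 ≤ T) (hTL : T ≤ L) :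
    MonotoneOn (fun z => (1 + T * ((Real.exp z + 1) / (Real.exp z - 1))) * ((z - L) / (z + L)))
      (Ioi L) := by
  have hL : 0 ≤ L := hT.trans hTL
  have hd : ∀ z ∈ Ioi L, HasDerivAt
      (fun z => (1 + T * ((Real.exp z + 1) / (Real.exp z - 1))) * ((z - L) / (z + L)))
      (T * (-(2 * Real.exp z) / (Real.exp z - 1) ^ 2) * ((z - L) / (z + L))
        + (1 + T * ((Real.exp z + 1) / (Real.exp z - 1))) * (2 * L / (z + L) ^ 2)) z := by
    intro z hz
    have hz' : L < z := hz
    have h1 : Real.exp z - 1 ≠ 0 := by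
      have := Real.add_one_lt_exp (x := z) (by linarith)
      linarith
    have h2 : z + L ≠ 0 := by linarith
    have h := (((((Real.hasDerivAt_exp z).add_const 1).div
      ((Real.hasDerivAt_exp z).sub_const 1) h1).const_mul T).const_add 1).mul
      (((hasDerivAt_id z).sub_const L).div ((hasDerivAt_id z).add_const L) h2)
    refine h.congr_deriv ?_
    simp only [id, Pi.div_apply]
    congr 3
    · congr 2; ring
    · ring
  refine monotoneOn_of_deriv_nonneg (convex_Ioi L)
    (fun x hx => (hd x hx).continuousAt.continuousWithinAt)
    (fun x hx => (hd x (interior_subset hx)).differentiableAt.differentiableWithinAt) ?_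
  intro z hz
  have hz' : L < z := interior_subset hz
  have hz0 : 0 < z := by linarith
  rw [(hd z hz').deriv]
  have hE : 0 < Real.exp z - 1 := by
    have := Real.add_one_lt_exp (x := z) (by linarith)
    linarith
  have hk := sq_mul_exp_le hz0.le
  have hzL : 0 < z + L := by linarith
  have h1 : T * (Real.exp z / (Real.exp z - 1) ^ 2) * ((z - L) * (z + L)) ≤ L := by
    have e : Real.exp z / (Real.exp z - 1) ^ 2 * z ^ 2 ≤ 1 := by
      rw [div_mul_eq_mul_div, div_le_one (by positivity)]
      linarith
    have e' : Real.exp z / (Real.exp z - 1) ^ 2 * ((z - L) * (z + L)) ≤ 1 := by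
      refine le_trans (mul_le_mul_of_nonneg_left ?_ (by positivity)) e
      nlinarith
    calc T * (Real.exp z / (Real.exp z - 1) ^ 2) * ((z - L) * (z + L))
        = T * (Real.exp z / (Real.exp z - 1) ^ 2 * ((z - L) * (z + L))) := by ring
      _ ≤ T * 1 := mul_le_mul_of_nonneg_left e' hT
      _ ≤ L := by linarith
  have h2 : 0 ≤ T * ((Real.exp z + 1) / (Real.exp z - 1)) * L := by positivity
  have e : T * (-(2 * Real.exp z) / (Real.exp z - 1) ^ 2) * ((z - L) / (z + L))
        + (1 + T * ((Real.exp z + 1) / (Real.exp z - 1))) * (2 * L / (z + L) ^ 2)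
      = 2 / (z + L) ^ 2 * ((L - T * (Real.exp z / (Real.exp z - 1) ^ 2) * ((z - L) * (z + L)))
        + T * ((Real.exp z + 1) / (Real.exp z - 1)) * L) := by
    field_simp
    ring
  rw [e]
  exact mul_nonneg (by positivity) (by linarith)

/-- The inequality that defines the threshold, for given `q₀` and `q₁`, without quotients. -/
def ThresholdIneq (n : ℕ) (lam q₀ q₁ : ℝ) : Prop :=
  (q₁ * (1 - q₁)) ^ ((n - 1) / 2) * (1 - 2 * q₁) * ((psi lam 1 - q₀) * (2 * lam + logOdds q₀))
    ≤ (q₀ * (1 - q₀)) ^ ((n - 1) / 2) * (1 - 2 * q₀)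
      * ((psi lam 1 - q₁) * (2 * lam - logOdds q₀))

lemma psi_zero_lt_iff {lam q : ℝ} (h0 : 0 < q) (h1 : q < 1) :
    psi lam 0 < q ↔ 0 < 2 * lam + logOdds q := by
  have h := logOdds_psi lam 0
  constructor
  · intro hq
    have := logOdds_lt (psi_pos lam 0) hq h1
    linarith
  · intro hq
    by_contra hn
    rcases (not_lt.mp hn).eq_or_lt with e | e
    · rw [e] at hq; linarith
    · have := logOdds_lt h0 e (psi_lt_one lam 0)
      linarith

lemma logOdds_half : logOdds (1 / 2) = 0 := by
  unfold logOdds; norm_num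

lemma logOdds_nonpos {q : ℝ} (h0 : 0 < q) (h1 : q ≤ 1 / 2) : logOdds q ≤ 0 := by
  rw [← logOdds_half]
  rcases h1.eq_or_lt with rfl | h
  · rfl
  · exact (logOdds_lt h0 h (by norm_num)).le

lemma half_lt_psi_one {lam : ℝ} (hlam : 0 < lam) : 1 / 2 < psi lam 1 := by
  have h : psi lam (1 / 2) = 1 / 2 := by rw [psi_eq]; norm_num
  rw [← h]
  exact psi_lt_psi_one hlam (by norm_num)

lemma mem_thresholdSet_iff {n : ℕ} {lam : ℝ} :
    lam ∈ thresholdSet n ↔ 0 ≤ lam ∧ ∀ q₀ q₁ : ℝ, psi lam 0 < q₀ → q₀ ≤ q₁ → q₁ ≤ 1 / 2 →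
      ThresholdIneq n lam q₀ q₁ := by
  unfold thresholdSet
  rw [mem_ofPred_eq]
  refine and_congr_right fun hlam => forall₂_congr fun q₀ q₁ => forall₃_congr fun h h01 h1 => ?_
  have hq0 : 0 < q₀ := (psi_pos _ _).trans h
  have hlt := (psi_zero_lt_iff hq0 (by linarith)).mp h
  have hnp := logOdds_nonpos hq0 (h01.trans h1)
  have hlam' : 0 < lam := by linarith
  have hQ := half_lt_psi_one hlam'
  have e1 : 2 * lam + Real.log (1 - q₀) - Real.log q₀ = 2 * lam - logOdds q₀ := by
    unfold logOdds; ring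
  have e2 : 2 * lam - Real.log (1 - q₀) + Real.log q₀ = 2 * lam + logOdds q₀ := by
    unfold logOdds; ring
  rw [e1, e2, div_mul_div_comm, div_le_div_iff₀ (by linarith)
    (mul_pos (by linarith) hlt), ThresholdIneq]
  constructor <;> intro h <;> linarith

lemma two_mul_psi_one_sub_one (lam : ℝ) :
    2 * psi lam 1 - 1 = (Real.exp (2 * lam) - 1) / (Real.exp (2 * lam) + 1) := by
  rw [psi_eq, show -(2 * lam * (2 * 1 - 1)) = -(2 * lam) by ring, Real.exp_neg]
  have := Real.exp_pos (2 * lam)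
  field_simp
  ring

lemma one_sub_two_mul_le_neg_logOdds {q : ℝ} (h0 : 0 < q) (h1 : q ≤ 1 / 2) :
    1 - 2 * q ≤ -logOdds q := by
  have h := logOdds_sub_ge h0 h1 (by norm_num)
  rw [logOdds_half] at h
  have hn := logOdds_nonpos h0 h1
  nlinarith

/-- For fixed q₀ and q₁, the quotient (ψ(1) - q₀)(2λ + logit q₀) / ((ψ(1) - q₁)(2λ - logit q₀)) is
nondecreasing in λ, so a smaller λ only relaxes the inequality. -/
lemma thresholdIneq_of_le {n : ℕ} {lam lam' q₀ q₁ : ℝ} (hle : lam ≤ lam')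
    (h0 : psi lam 0 < q₀) (h01 : q₀ ≤ q₁) (h1 : q₁ ≤ 1 / 2)
    (h : ThresholdIneq n lam' q₀ q₁) : ThresholdIneq n lam q₀ q₁ := by
  have hq0 : 0 < q₀ := (psi_pos _ _).trans h0
  have hlt := (psi_zero_lt_iff hq0 (by linarith)).mp h0
  have hnp := logOdds_nonpos hq0 (h01.trans h1)
  have hlam : 0 < lam := by linarith
  have hlam' : 0 < lam' := by linarith
  have hQ := half_lt_psi_one hlam
  have hQ' := half_lt_psi_one hlam'
  unfold ThresholdIneq at h ⊢
  set W₁ := (q₁ * (1 - q₁)) ^ ((n - 1) / 2) * (1 - 2 * q₁) with hW1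
  set W₀ := (q₀ * (1 - q₀)) ^ ((n - 1) / 2) * (1 - 2 * q₀) with hW0
  have hW1n : 0 ≤ W₁ := by
    refine mul_nonneg (pow_nonneg (mul_nonneg ?_ ?_) _) ?_ <;> linarith
  have hTL := one_sub_two_mul_le_neg_logOdds hq0 (h01.trans h1)
  have hm := monotoneOn_one_add_mul_div (T := 1 - 2 * q₀) (L := -logOdds q₀)
    (by linarith) hTL (show 2 * lam ∈ Ioi _ by simp only [mem_Ioi]; linarith)
    (show 2 * lam' ∈ Ioi _ by simp only [mem_Ioi]; linarith) (by linarith)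
  have hinv : ∀ l : ℝ, (Real.exp (2 * l) + 1) / (Real.exp (2 * l) - 1) = (2 * psi l 1 - 1)⁻¹ := by
    intro l
    rw [two_mul_psi_one_sub_one, inv_div]
  simp only [hinv, sub_neg_eq_add, ← sub_eq_add_neg] at hm
  set Q := psi lam 1
  set Q' := psi lam' 1
  set ℓ := logOdds q₀
  have a1 : 0 < 2 * lam - ℓ := by linarith
  have a1' : 0 < 2 * lam' - ℓ := by linarith
  have b1 : 0 < 2 * Q - 1 := by linarith
  have b1' : 0 < 2 * Q' - 1 := by linarith
  have hmid : (Q - q₀) * (2 * lam + ℓ) * ((2 * Q' - 1) * (2 * lam' - ℓ))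
      ≤ (Q' - q₀) * (2 * lam' + ℓ) * ((2 * Q - 1) * (2 * lam - ℓ)) := by
    have e : ∀ l P : ℝ, 0 < 2 * l - ℓ → 0 < 2 * P - 1 →
        (1 + (1 - 2 * q₀) * (2 * P - 1)⁻¹) * ((2 * l + ℓ) / (2 * l - ℓ))
          = 2 * ((P - q₀) * (2 * l + ℓ)) / ((2 * P - 1) * (2 * l - ℓ)) := by
      intro l P h1 h2
      field_simp
      ring
    rw [e _ _ a1 b1, e _ _ a1' b1', div_le_div_iff₀ (by positivity) (by positivity)] at hm
    linarith
  have hend : (2 * lam + ℓ) * (2 * lam' - ℓ) ≤ (2 * lam' + ℓ) * (2 * lam - ℓ) := by nlinarith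
  -- Both sides are affine in `q₁`, so it suffices to check q₁ = q₀ (`hend`) and q₁ = 1/2 (`hmid`).
  have hcross : (Q - q₀) * (2 * lam + ℓ) * ((Q' - q₁) * (2 * lam' - ℓ))
      ≤ (Q' - q₀) * (2 * lam' + ℓ) * ((Q - q₁) * (2 * lam - ℓ)) := by
    rcases (h01.trans h1).eq_or_lt with e | e
    · have : q₁ = 1 / 2 := le_antisymm h1 (e ▸ h01)
      rw [this]
      linarith
    · obtain ⟨s, hs⟩ : ∃ s, s = (q₁ - q₀) / (1 / 2 - q₀) := ⟨_, rfl⟩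
      have hd : 0 < 1 / 2 - q₀ := by linarith
      have hs0 : 0 ≤ s := by rw [hs]; exact div_nonneg (by linarith) hd.le
      have hs1 : s ≤ 1 := by rw [hs, div_le_one hd]; linarith
      have hq : q₁ = (1 - s) * q₀ + s * (1 / 2) := by
        have : s * (1 / 2 - q₀) = q₁ - q₀ := by rw [hs]; exact div_mul_cancel₀ _ hd.ne'
        linarith
      have k1 := mul_le_mul_of_nonneg_left hmid (show 0 ≤ s / 2 by linarith)
      have k2 := mul_le_mul_of_nonneg_left hend
        (show 0 ≤ (1 - s) * ((Q - q₀) * (Q' - q₀)) by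
          refine mul_nonneg (by linarith) (mul_nonneg ?_ ?_) <;> linarith)
      rw [hq]
      linarith
  have hp : 0 < (Q' - q₀) * (2 * lam' + ℓ) := mul_pos (by linarith) (by linarith)
  have hp2 : 0 ≤ (Q - q₀) * (2 * lam + ℓ) := mul_nonneg (by linarith) hlt.le
  have hp3 : 0 < (Q' - q₁) * (2 * lam' - ℓ) := mul_pos (by linarith) a1'
  have hp4 : 0 ≤ (Q - q₁) * (2 * lam - ℓ) := mul_nonneg (by linarith) a1.le
  have k1 := mul_le_mul_of_nonneg_right h hp4
  have k2 := mul_le_mul_of_nonneg_left hcross hW1n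
  rw [← mul_le_mul_iff_left₀ hp3]
  linarith

lemma mem_thresholdSet_of_le {n : ℕ} {lam lam' : ℝ} (h0 : 0 ≤ lam) (hle : lam ≤ lam')
    (h : lam' ∈ thresholdSet n) : lam ∈ thresholdSet n := by
  rw [mem_thresholdSet_iff] at h ⊢
  refine ⟨h0, fun q₀ q₁ hq h01 h1 => thresholdIneq_of_le hle hq h01 h1 (h.2 q₀ q₁ ?_ h01 h1)⟩
  refine lt_of_le_of_lt ?_ hq
  rw [psi_eq, psi_eq, show -(2 * lam' * (2 * 0 - 1)) = 2 * lam' by ring,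
    show -(2 * lam * (2 * 0 - 1)) = 2 * lam by ring]
  gcongr

/-- The case λ = g(n) needs a left limit: ψ_l(0) < q₀ is an open condition on l, and the inequality
without quotients is continuous in l. -/
theorem mem_thresholdSet_of_le_threshold {n : ℕ} {lam : ℝ} (h0 : 0 ≤ lam)
    (h : (lam : EReal) ≤ threshold n) : lam ∈ thresholdSet n := by
  have hlt : ∀ l : ℝ, 0 ≤ l → l < lam → l ∈ thresholdSet n := by
    intro l hl hll
    have : (l : EReal) < threshold n := (EReal.coe_lt_coe_iff.mpr hll).trans_le h
    obtain ⟨_, ⟨l', hl', rfl⟩, hlt'⟩ := lt_sSup_iff.mp this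
    exact mem_thresholdSet_of_le hl (EReal.coe_lt_coe_iff.mp hlt').le hl'
  rw [mem_thresholdSet_iff]
  refine ⟨h0, fun q₀ q₁ hq h01 h1 => ?_⟩
  have hq0 : 0 < q₀ := (psi_pos _ _).trans hq
  have hpos := (psi_zero_lt_iff hq0 (by linarith)).mp hq
  have hnp := logOdds_nonpos hq0 (h01.trans h1)
  have hlam : 0 < lam := by linarith
  have hcont : Continuous fun l => psi l 1 := by
    have : (fun l => psi l 1) = fun l => (1 + Real.exp (-(2 * l * (2 * 1 - 1))))⁻¹ :=
      funext fun l => psi_eq l 1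
    rw [this]
    exact Continuous.inv₀ (by fun_prop) fun p => by positivity
  unfold ThresholdIneq
  have hL : Filter.Tendsto (fun l => (q₁ * (1 - q₁)) ^ ((n - 1) / 2) * (1 - 2 * q₁)
      * ((psi l 1 - q₀) * (2 * l + logOdds q₀))) (nhdsWithin lam (Iio lam)) (nhds _) :=
    (Continuous.tendsto (by fun_prop) lam).mono_left nhdsWithin_le_nhds
  have hR : Filter.Tendsto (fun l => (q₀ * (1 - q₀)) ^ ((n - 1) / 2) * (1 - 2 * q₀)
      * ((psi l 1 - q₁) * (2 * l - logOdds q₀))) (nhdsWithin lam (Iio lam)) (nhds _) :=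
    (Continuous.tendsto (by fun_prop) lam).mono_left nhdsWithin_le_nhds
  refine le_of_tendsto_of_tendsto hL hR ?_
  have hev : ∀ᶠ l in nhdsWithin lam (Iio lam), max 0 (-logOdds q₀ / 2) < l :=
    nhdsWithin_le_nhds (lt_mem_nhds (max_lt hlam (by linarith)))
  filter_upwards [hev, self_mem_nhdsWithin] with l hl hl'
  have hl0 := (le_max_left _ _).trans_lt hl
  have hl1 := (le_max_right _ _).trans_lt hl
  exact (mem_thresholdSet_iff.mp (hlt l hl0.le hl')).2 q₀ q₁
    ((psi_zero_lt_iff hq0 (by linarith)).mpr (by linarith)) h01 h1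

/-- The power has exponent 0. Then (1 - 2q)/(ψ(1) - q) is nonincreasing in q, as ψ(1) > 1/2, and the
last factor is at least 1, as logit q₀ ≤ 0. -/
theorem threshold_eq_top {n : ℕ} (hn : n ≤ 2) : threshold n = ⊤ := by
  have hmem : ∀ lam : ℝ, 0 ≤ lam → lam ∈ thresholdSet n := by
    intro lam hlam
    rw [mem_thresholdSet_iff]
    refine ⟨hlam, fun q₀ q₁ hq h01 h1 => ?_⟩
    have hq0 : 0 < q₀ := (psi_pos _ _).trans hq
    have hpos := (psi_zero_lt_iff hq0 (by linarith)).mp hq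
    have hnp := logOdds_nonpos hq0 (h01.trans h1)
    have hQ := half_lt_psi_one (show 0 < lam by linarith)
    unfold ThresholdIneq
    rw [show (n - 1) / 2 = 0 by omega, pow_zero, pow_zero, one_mul, one_mul]
    have k1 : (1 - 2 * q₁) * (psi lam 1 - q₀) ≤ (1 - 2 * q₀) * (psi lam 1 - q₁) := by nlinarith
    have k2 : 0 ≤ (1 - 2 * q₀) * (psi lam 1 - q₁) := mul_nonneg (by linarith) (by linarith)
    calc (1 - 2 * q₁) * ((psi lam 1 - q₀) * (2 * lam + logOdds q₀))
        = (1 - 2 * q₁) * (psi lam 1 - q₀) * (2 * lam + logOdds q₀) := by ring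
      _ ≤ (1 - 2 * q₀) * (psi lam 1 - q₁) * (2 * lam + logOdds q₀) :=
          mul_le_mul_of_nonneg_right k1 hpos.le
      _ ≤ (1 - 2 * q₀) * (psi lam 1 - q₁) * (2 * lam - logOdds q₀) :=
          mul_le_mul_of_nonneg_left (by linarith) k2
      _ = _ := by ring
  rw [EReal.eq_top_iff_forall_lt]
  intro y
  refine lt_sSup_iff.mpr ⟨_, ⟨max y 0 + 1, hmem _ (by positivity), rfl⟩, ?_⟩
  exact EReal.coe_lt_coe_iff.mpr (by linarith [le_max_left y 0])

/-! ### Comparison of opposite margins -/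

/-- The symmetric sums `(b ^ (2 * i + 1) - a ^ (2 * i + 1)) / ((b - a) * (a * b) ^ i)` (for `s = 1`)
and `(b ^ (2 * i + 2) - a ^ (2 * i + 2)) / ((b - a) * (a * b) ^ i)` (for `s = 0`), where
`a + b = 1`, as polynomials in `y = 1 / (a * b) - 2`. -/
def symmSum (s y : ℝ) : ℕ → ℝ
  | 0 => 1
  | 1 => y + s
  | i + 2 => y * symmSum s y (i + 1) - symmSum s y i

/-- Monotonicity in y does not propagate through the recurrence by itself. The increments must be
carried along: each is the previous one plus (y - 2) times a nonnegative term that is monotone in y.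
-/
lemma symmSum_mono {s y y' : ℝ} (hs : 0 ≤ s) (hy : 2 ≤ y) (hyy : y ≤ y') (i : ℕ) :
    0 ≤ symmSum s y i ∧ symmSum s y i ≤ symmSum s y' i ∧
      0 ≤ symmSum s y (i + 1) - symmSum s y i ∧
      symmSum s y (i + 1) - symmSum s y i ≤ symmSum s y' (i + 1) - symmSum s y' i := by
  induction i with
  | zero =>
    simp only [symmSum]
    refine ⟨by norm_num, le_rfl, by linarith, by linarith⟩
  | succ i ih =>
    obtain ⟨h1, h2, h3, h4⟩ := ih
    have e : ∀ t, symmSum s t (i + 1 + 1) - symmSum s t (i + 1)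
        = (t - 2) * symmSum s t (i + 1) + (symmSum s t (i + 1) - symmSum s t i) := by
      intro t
      simp only [symmSum]
      ring
    refine ⟨by linarith, by linarith, ?_, ?_⟩
    · rw [e]
      have := mul_nonneg (show 0 ≤ y - 2 by linarith) (show 0 ≤ symmSum s y (i + 1) by linarith)
      linarith
    · rw [e, e]
      have := mul_le_mul (show y - 2 ≤ y' - 2 by linarith)
        (show symmSum s y (i + 1) ≤ symmSum s y' (i + 1) by linarith) (by linarith) (by linarith)
      linarith

lemma pow_sub_pow_eq_symmSum_odd {a : ℝ} (h0 : a ≠ 0) (h1 : 1 - a ≠ 0) (i : ℕ) :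
    (1 - a) ^ (2 * i + 1) - a ^ (2 * i + 1)
      = (1 - 2 * a) * (a * (1 - a)) ^ i * symmSum 1 (1 / (a * (1 - a)) - 2) i := by
  induction i using Nat.twoStepInduction with
  | zero => simp [symmSum]; ring
  | one => simp only [symmSum]; field_simp; ring
  | more i ih1 ih2 =>
    have e : (1 - a) ^ (2 * (i + 2) + 1) - a ^ (2 * (i + 2) + 1)
        = (1 - 2 * (a * (1 - a))) * ((1 - a) ^ (2 * (i + 1) + 1) - a ^ (2 * (i + 1) + 1))
          - (a * (1 - a)) ^ 2 * ((1 - a) ^ (2 * i + 1) - a ^ (2 * i + 1)) := by ring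
    rw [e, ih1, ih2, symmSum]
    field_simp
    ring

lemma pow_sub_pow_eq_symmSum_even {a : ℝ} (h0 : a ≠ 0) (h1 : 1 - a ≠ 0) (i : ℕ) :
    (1 - a) ^ (2 * i + 2) - a ^ (2 * i + 2)
      = (1 - 2 * a) * (a * (1 - a)) ^ i * symmSum 0 (1 / (a * (1 - a)) - 2) i := by
  induction i using Nat.twoStepInduction with
  | zero => simp [symmSum]; ring
  | one => simp only [symmSum]; field_simp; ring
  | more i ih1 ih2 =>
    have e : (1 - a) ^ (2 * (i + 2) + 2) - a ^ (2 * (i + 2) + 2)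
        = (1 - 2 * (a * (1 - a))) * ((1 - a) ^ (2 * (i + 1) + 2) - a ^ (2 * (i + 1) + 2))
          - (a * (1 - a)) ^ 2 * ((1 - a) ^ (2 * i + 2) - a ^ (2 * i + 2)) := by ring
    rw [e, ih1, ih2, symmSum]
    field_simp
    ring

/-- The advantage of `n - x` votes over `x` votes, relative to that of the smallest minority over
the smallest majority, decreases with the probability of a vote. -/
lemma pow_mul_pow_sub_ratio_le {n x : ℕ} (hx : x ≤ n) (hn : n < 2 * x) {a a' : ℝ} (h0 : 0 < a)
    (haa : a ≤ a') (h1 : a' ≤ 1 / 2) :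
    (a' ^ (n - x) * (1 - a') ^ x - a' ^ x * (1 - a') ^ (n - x))
        * ((a * (1 - a)) ^ ((n - 1) / 2) * (1 - 2 * a))
      ≤ (a ^ (n - x) * (1 - a) ^ x - a ^ x * (1 - a) ^ (n - x))
        * ((a' * (1 - a')) ^ ((n - 1) / 2) * (1 - 2 * a')) := by
  -- The parity of `n` selects `s`; `i` counts how far `x` lies above the smallest majority. The
  -- ratio in question is then a `symmSum` at y = 1/(b(1-b)) - 2, which decreases in b on (0, 1/2].
  obtain ⟨s, i, hs, hi, hV⟩ : ∃ (s : ℝ) (i : ℕ), 0 ≤ s ∧ i ≤ (n - 1) / 2 ∧ ∀ b : ℝ, 0 < b →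
      b ≤ 1 / 2 → b ^ (n - x) * (1 - b) ^ x - b ^ x * (1 - b) ^ (n - x)
        = (b * (1 - b)) ^ ((n - 1) / 2) * (1 - 2 * b) * symmSum s (1 / (b * (1 - b)) - 2) i := by
    obtain ⟨k, hk⟩ : ∃ k, k = n - x := ⟨_, rfl⟩
    rcases Nat.even_or_odd' n with ⟨m, hm | hm⟩
    · refine ⟨0, x - m - 1, le_rfl, by omega, fun b hb hb' => ?_⟩
      rw [← hk, show x = k + (2 * (x - m - 1) + 2) by omega,
        show (n - 1) / 2 = k + (x - m - 1) by omega,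
        show k + (2 * (x - m - 1) + 2) - m - 1 = x - m - 1 by omega]
      have := pow_sub_pow_eq_symmSum_even hb.ne' (by linarith) (x - m - 1)
      calc b ^ k * (1 - b) ^ (k + (2 * (x - m - 1) + 2))
            - b ^ (k + (2 * (x - m - 1) + 2)) * (1 - b) ^ k
          = (b * (1 - b)) ^ k * ((1 - b) ^ (2 * (x - m - 1) + 2) - b ^ (2 * (x - m - 1) + 2)) := by
            rw [mul_pow, pow_add, pow_add]; ring
        _ = _ := by rw [this, pow_add]; ring
    · refine ⟨1, x - m - 1, zero_le_one, by omega, fun b hb hb' => ?_⟩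
      rw [← hk, show x = k + (2 * (x - m - 1) + 1) by omega,
        show (n - 1) / 2 = k + (x - m - 1) by omega,
        show k + (2 * (x - m - 1) + 1) - m - 1 = x - m - 1 by omega]
      have := pow_sub_pow_eq_symmSum_odd hb.ne' (by linarith) (x - m - 1)
      calc b ^ k * (1 - b) ^ (k + (2 * (x - m - 1) + 1))
            - b ^ (k + (2 * (x - m - 1) + 1)) * (1 - b) ^ k
          = (b * (1 - b)) ^ k * ((1 - b) ^ (2 * (x - m - 1) + 1) - b ^ (2 * (x - m - 1) + 1)) := by
            rw [mul_pow, pow_add, pow_add]; ring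
        _ = _ := by rw [this, pow_add]; ring
  have ha' : 0 < a' := h0.trans_le haa
  have hp : 0 < a * (1 - a) := mul_pos h0 (by linarith)
  have hp' : 0 < a' * (1 - a') := mul_pos ha' (by linarith)
  have hy : 2 ≤ 1 / (a' * (1 - a')) - 2 := by
    rw [le_sub_iff_add_le, le_div_iff₀ hp']
    nlinarith [sq_nonneg (1 - 2 * a')]
  have hyy : 1 / (a' * (1 - a')) - 2 ≤ 1 / (a * (1 - a)) - 2 := by
    have : a * (1 - a) ≤ a' * (1 - a') := by nlinarith
    linarith [one_div_le_one_div_of_le hp this]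
  have hS := (symmSum_mono hs hy hyy i).2.1
  rw [hV a h0 (haa.trans h1), hV a' ha' h1]
  have hW : 0 ≤ (a * (1 - a)) ^ ((n - 1) / 2) * (1 - 2 * a) := mul_nonneg (by positivity) (by linarith)
  have hW' : 0 ≤ (a' * (1 - a')) ^ ((n - 1) / 2) * (1 - 2 * a') :=
    mul_nonneg (by positivity) (by linarith)
  have := mul_le_mul_of_nonneg_left hS (mul_nonneg hW hW')
  linarith

/-- Margins change sign at most once. -/
lemma margin_nonpos_of_margin_neg {n : ℕ} {c a : Bool → ℝ} (hc : ∀ w, 0 ≤ c w) (h0 : 0 < a false)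
    (ha : a false ≤ a true) (h1 : a true < 1) {x y : ℕ} (hyx : y ≤ x) (hx : x ≤ n)
    (h : margin (binomialReport n c a) x < 0) : margin (binomialReport n c a) y ≤ 0 := by
  rw [margin_binomialReport] at h ⊢
  refine mul_nonpos_of_nonneg_of_nonpos (by positivity) ?_
  have hch : (0 : ℝ) < n.choose x := by exact_mod_cast Nat.choose_pos hx
  have hlt : c true * (a true ^ x * (1 - a true) ^ (n - x))
      < c false * (a false ^ x * (1 - a false) ^ (n - x)) := by
    have := neg_of_mul_neg_right h hch.le
    linarith
  obtain ⟨d, rfl⟩ := Nat.exists_eq_add_of_le hyx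
  have h0' : 0 < a true := h0.trans_le ha
  have hb1 : 0 < 1 - a true := by linarith
  have hb0 : 0 < 1 - a false := by linarith
  rw [show n - y = n - (y + d) + d by omega]
  set e := n - (y + d)
  -- Monotone likelihood ratio: `d` fewer votes shift the odds towards the state 0.
  have hr : (1 - a true) ^ d * a false ^ d ≤ (1 - a false) ^ d * a true ^ d := by
    rw [← mul_pow, ← mul_pow]
    refine pow_le_pow_left₀ (by positivity) ?_ d
    nlinarith
  have hp : 0 < a true ^ d * a false ^ d := by positivity
  have hX : 0 ≤ c true * (a true ^ (y + d) * (1 - a true) ^ e) := mul_nonneg (hc _) (by positivity)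
  have k := mul_le_mul hlt.le hr (by positivity) (hX.trans hlt.le)
  rw [sub_nonpos, ← mul_le_mul_iff_left₀ hp]
  calc c true * (a true ^ y * (1 - a true) ^ (e + d)) * (a true ^ d * a false ^ d)
      = c true * (a true ^ (y + d) * (1 - a true) ^ e) * ((1 - a true) ^ d * a false ^ d) := by
        rw [pow_add, pow_add]; ring
    _ ≤ _ := k
    _ = _ := by rw [pow_add, pow_add]; ring

/-! ### Robustness of majority voting below the threshold -/

/-- Below the threshold, the smallest minority is, relative to the opposite majority, at least as
likely in the state `0` as in the state `1`. -/
lemma IsVoteProfile.prior_mul_minority_le {n : ℕ} {lam : ℝ} (hlam : lam ∈ thresholdSet n)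
    {m : Measure unitInterval} [IsProbabilityMeasure m] {c a : Bool → ℝ}
    (h : IsVoteProfile (psi lam) m c a) (hl : ∀ w, psi lam 0 ≤ a w) (ha : a false ≤ a true)
    (h1 : a true < 1 / 2) :
    c true * ((a true * (1 - a true)) ^ ((n - 1) / 2) * (1 - 2 * a true))
      ≤ c false * ((a false * (1 - a false)) ^ ((n - 1) / 2) * (1 - 2 * a false)) := by
  rw [mem_thresholdSet_iff] at hlam
  obtain ⟨hlam0, hineq⟩ := hlam
  have hf0 : 0 < a false := (psi_pos lam 0).trans_le (hl false)
  have hf1 : a false < 1 / 2 := ha.trans_lt h1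
  have hlam : 0 < lam := by
    refine lt_of_le_of_ne hlam0 fun e => ?_
    have := hl false
    rw [← e, psi_eq] at this
    norm_num at this
    linarith
  have hQ := half_lt_psi_one hlam
  -- The posterior at which an expert votes 1 with probability `a false`, obtained by inverting
  -- `logOdds_psi`.
  obtain ⟨p₀, hp₀⟩ : ∃ p₀ : ℝ, p₀ = (2 * lam + logOdds (a false)) / (4 * lam) := ⟨_, rfl⟩
  have hpe : 4 * lam * p₀ = 2 * lam + logOdds (a false) := by rw [hp₀]; field_simp
  have hap : a false = psi lam p₀ := by
    refine eq_of_logOdds_eq hf0 (by linarith) (psi_pos _ _) (psi_lt_one _ _) ?_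
    rw [logOdds_psi]
    linarith
  have hlog := logOdds_nonpos hf0 hf1.le
  have hp₀1 : p₀ < 1 := by nlinarith
  have hle := h.prior_mul_le hlam hp₀1 hap
  have hc0 := h.prior_nonneg false
  have hc1 := h.prior_nonneg true
  have ht1 : 0 < psi lam 1 - a true := by linarith
  have hW0 : 0 ≤ (a false * (1 - a false)) ^ ((n - 1) / 2) * (1 - 2 * a false) :=
    mul_nonneg (pow_nonneg (mul_nonneg hf0.le (by linarith)) _) (by linarith)
  have hW1 : 0 ≤ (a true * (1 - a true)) ^ ((n - 1) / 2) * (1 - 2 * a true) :=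
    mul_nonneg (pow_nonneg (mul_nonneg (by linarith) (by linarith)) _) (by linarith)
  -- At the endpoint excluded from the threshold condition, p₀ = 0 and the bound on the prior forces
  -- `c true = 0`.
  rcases (hl false).eq_or_lt with e | hlt
  · have hp0 : p₀ = 0 := by
      rw [← e, logOdds_psi] at hpe
      nlinarith
    rw [hp0, zero_div, mul_zero, mul_zero] at hle
    have : c true = 0 := by
      by_contra hne
      have := mul_pos (lt_of_le_of_ne hc1 (Ne.symm hne)) ht1
      linarith
    rw [this, zero_mul]
    exact mul_nonneg hc0 hW0
  · have hT := hineq (a false) (a true) hlt ha h1.le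
    have hpos := (psi_zero_lt_iff hf0 (by linarith)).mp hlt
    unfold ThresholdIneq at hT
    set W₁ := (a true * (1 - a true)) ^ ((n - 1) / 2) * (1 - 2 * a true)
    set W₀ := (a false * (1 - a false)) ^ ((n - 1) / 2) * (1 - 2 * a false)
    have hodds : p₀ / (1 - p₀) = (2 * lam + logOdds (a false)) / (2 * lam - logOdds (a false)) := by
      rw [div_eq_div_iff (by linarith) (by linarith)]
      linear_combination hpe
    have hd : 0 < 2 * lam - logOdds (a false) := by linarith
    rw [hodds] at hle
    have hle' : c true * (psi lam 1 - a true) * (2 * lam - logOdds (a false))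
        ≤ c false * ((psi lam 1 - a false) * (2 * lam + logOdds (a false))) := by
      have := mul_le_mul_of_nonneg_right hle hd.le
      refine this.trans (le_of_eq ?_)
      field_simp
    have k1 := mul_le_mul_of_nonneg_right hle' hW1
    have k2 := mul_le_mul_of_nonneg_left hT hc0
    have hp : 0 < (psi lam 1 - a true) * (2 * lam - logOdds (a false)) := mul_pos ht1 hd
    rw [← mul_le_mul_iff_left₀ hp]
    linarith

/-- If the state `1` has the larger mass at every majority for it, the margin at a majority is at
least the margin at the opposite minority. -/
theorem IsVoteProfile.margin_rev_le {n : ℕ} {lam : ℝ} (hlam : lam ∈ thresholdSet n)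
    {m : Measure unitInterval} [IsProbabilityMeasure m] {c a : Bool → ℝ}
    (h : IsVoteProfile (psi lam) m c a) (hl : ∀ w, psi lam 0 ≤ a w) (hu : ∀ w, a w ≤ psi lam 1)
    (ha : a false ≤ a true) {x : ℕ} (hx : x ≤ n) (hn : n < 2 * x)
    (hm : 0 ≤ margin (binomialReport n c a) x) :
    margin (binomialReport n c a) (n - x) ≤ margin (binomialReport n c a) x := by
  have hc0 := h.prior_nonneg false
  have hc1 := h.prior_nonneg true
  have hf0 : 0 < a false := (psi_pos lam 0).trans_le (hl false)
  have hf1 : 0 < 1 - a false := by linarith [hu false, psi_lt_one lam 1]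
  have ht0 : 0 < a true := (psi_pos lam 0).trans_le (hl true)
  have ht1 : 0 < 1 - a true := by linarith [hu true, psi_lt_one lam 1]
  have hch : (0 : ℝ) < n.choose x := by exact_mod_cast Nat.choose_pos hx
  rw [margin_binomialReport] at hm
  rw [margin_binomialReport, margin_binomialReport, Nat.choose_symm hx,
    show n - (n - x) = x by omega]
  refine mul_le_mul_of_nonneg_left ?_ hch.le
  have hm' := nonneg_of_mul_nonneg_right hm hch
  obtain ⟨j, hj⟩ : ∃ j, x = n - x + j := ⟨2 * x - n, by omega⟩
  have hfac : ∀ b : ℝ, b ^ (n - x) * (1 - b) ^ x - b ^ x * (1 - b) ^ (n - x)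
      = (b * (1 - b)) ^ (n - x) * ((1 - b) ^ j - b ^ j) := by
    intro b
    generalize n - x = k at hj
    rw [hj, mul_pow, pow_add, pow_add]
    ring
  rcases lt_or_ge (a true) (1 / 2) with h1 | h1
  · have hprior := h.prior_mul_minority_le hlam hl ha h1
    have hratio := pow_mul_pow_sub_ratio_le hx hn hf0 ha h1.le
    have hV0 : 0 ≤ a false ^ (n - x) * (1 - a false) ^ x - a false ^ x * (1 - a false) ^ (n - x) := by
      rw [hfac]
      refine mul_nonneg (by positivity) (sub_nonneg.mpr (pow_le_pow_left₀ hf0.le (by linarith) j))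
    have hW0 : 0 < (a false * (1 - a false)) ^ ((n - 1) / 2) * (1 - 2 * a false) :=
      mul_pos (by positivity) (by linarith)
    have k1 := mul_le_mul_of_nonneg_left hratio hc1
    have k2 := mul_le_mul_of_nonneg_left hprior hV0
    have : c true * (a true ^ (n - x) * (1 - a true) ^ x - a true ^ x * (1 - a true) ^ (n - x))
        ≤ c false * (a false ^ (n - x) * (1 - a false) ^ x
          - a false ^ x * (1 - a false) ^ (n - x)) := by
      rw [← mul_le_mul_iff_left₀ hW0]
      linarith
    linarith
  -- If 1/2 separates the vote probabilities, each state by itself favours the inequality. If both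
  -- exceed 1/2, passing from n - x to x votes multiplies the two masses by factors at least 1, the
  -- larger one for the state 1.
  · rcases le_or_gt (a false) (1 / 2) with h2 | h2
    · have e0 : 0 ≤ a false ^ (n - x) * (1 - a false) ^ x
          - a false ^ x * (1 - a false) ^ (n - x) := by
        rw [hfac]
        exact mul_nonneg (by positivity) (sub_nonneg.mpr (pow_le_pow_left₀ hf0.le (by linarith) j))
      have e1 : a true ^ (n - x) * (1 - a true) ^ x - a true ^ x * (1 - a true) ^ (n - x) ≤ 0 := by
        rw [hfac]
        exact mul_nonpos_of_nonneg_of_nonpos (by positivity)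
          (sub_nonpos.mpr (pow_le_pow_left₀ ht1.le (by linarith) j))
      have := mul_nonneg hc0 e0
      have := mul_nonpos_of_nonneg_of_nonpos hc1 e1
      linarith
    · set u := c true * (a true ^ (n - x) * (1 - a true) ^ x) with hu'
      set v := c false * (a false ^ (n - x) * (1 - a false) ^ x) with hv'
      rcases le_or_gt u v with huv | huv
      · linarith
      · have hR : ∀ b : ℝ, 0 < 1 - b → b ^ x * (1 - b) ^ (n - x)
            = b ^ (n - x) * (1 - b) ^ x * (b / (1 - b)) ^ j := by
          intro b hb
          generalize n - x = k at hj
          rw [hj, pow_add, pow_add, div_pow]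
          field_simp
        rw [hR _ ht1, hR _ hf1, ← mul_assoc, ← mul_assoc (c false), ← hu', ← hv']
        have r0 : 1 ≤ (a false / (1 - a false)) ^ j :=
          one_le_pow₀ ((one_le_div hf1).mpr (by linarith))
        have r1 : (a false / (1 - a false)) ^ j ≤ (a true / (1 - a true)) ^ j := by
          refine pow_le_pow_left₀ (by positivity) ?_ j
          exact div_le_div₀ ht0.le ha ht1 (by linarith)
        have hu0 : 0 ≤ u := mul_nonneg hc1 (by positivity)
        nlinarith

/-- Below the threshold, majority voting minimizes the worst-case regret. -/
theorem worstRegret_majority_le {n : ℕ} (hn : 1 ≤ n) {lam : ℝ} (hlam : lam ∈ thresholdSet n)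
    (f : Aggregator n) :
    worstRegret n (psi lam) (majority n) ≤ worstRegret n (psi lam) f := by
  have hlam0 : 0 ≤ lam := hlam.1
  have hψ := (continuous_psi lam).measurable
  have hC : ∀ p, |psi lam p| ≤ 1 := fun p => by
    rw [abs_of_pos (psi_pos lam p)]; exact (psi_lt_one lam p).le
  obtain ⟨⟨r, hr, hworst⟩, -⟩ := isGreatest_worstRegret hn hlam0 (majority n)
  have hub : ∀ r ∈ ciidReports n (psi lam), regret f r ≤ worstRegret n (psi lam) f :=
    fun r hr => (isGreatest_worstRegret hn hlam0 f).2 ⟨r, hr, rfl⟩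
  obtain ⟨m, c, a, h, hl, hu, ha, rfl⟩ := exists_isVoteProfile_of_mem_ciidReports hn hlam0 hr
  have key : ∀ (m : ProbabilityMeasure unitInterval) (c a : Bool → ℝ),
      IsVoteProfile (psi lam) m c a → (∀ w, psi lam 0 ≤ a w) → (∀ w, a w ≤ psi lam 1) →
      a false ≤ a true → (∀ x ≤ n, n < 2 * x → 0 ≤ margin (binomialReport n c a) x) →
      regret (majority n) (binomialReport n c a) ≤ worstRegret n (psi lam) f := by
    intro m c a h hl hu ha hpos
    let m' : ProbabilityMeasure unitInterval :=
      m.map unitInterval.continuous_symm.measurable.aemeasurable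
    have h' : IsVoteProfile (psi lam) m' (fun w => c !w) (fun w => 1 - a !w) :=
      h.mirror hψ hC (psi_one_sub lam)
    have hmem := mem_ciidReports_of_isVoteProfile hn hψ (fun p => (psi_pos lam p).le)
      (fun p => (psi_lt_one lam p).le) m h
    have hmem' := mem_ciidReports_of_isVoteProfile hn hψ (fun p => (psi_pos lam p).le)
      (fun p => (psi_lt_one lam p).le) m' h'
    have hnn := ciidReports_nonneg hn hlam0 hmem
    have hnn' := ciidReports_nonneg hn hlam0 hmem'
    have hrev := margin_binomialReport_mirror n c a
    have h1 := regret_majority_add_le hnn hnn' hrev (fun x hx => by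
      have hxn := x.2
      rw [show ((x.rev : Fin (n + 1)) : ℕ) = n - x by simp [Fin.val_rev]]
      exact h.margin_rev_le hlam hl hu ha (by omega) hx (hpos x (by omega) hx)) f
    have h2 := regret_majority_eq_of_margin_rev hnn hnn' hrev
    have h3 := hub _ hmem
    have h4 := hub _ hmem'
    linarith
  rw [← hworst]
  by_cases hpos : ∀ x ≤ n, n < 2 * x → 0 ≤ margin (binomialReport n c a) x
  · exact key m c a h hl hu ha hpos
  -- A negative margin at the majority `x₀` makes all margins at y ≤ x₀ nonpositive, in particular
  -- those at minorities. The mirror image then has nonnegative margins at all majorities, and the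
  -- same regret under majority voting.
  · push Not at hpos
    obtain ⟨x₀, hx₀, hx₀', hneg⟩ := hpos
    let m' : ProbabilityMeasure unitInterval :=
      m.map unitInterval.continuous_symm.measurable.aemeasurable
    have h' : IsVoteProfile (psi lam) m' (fun w => c !w) (fun w => 1 - a !w) :=
      h.mirror hψ hC (psi_one_sub lam)
    have hrev := margin_binomialReport_mirror n c a
    have hmem' := mem_ciidReports_of_isVoteProfile hn hψ (fun p => (psi_pos lam p).le)
      (fun p => (psi_lt_one lam p).le) m' h'
    have e01 : psi lam 1 = 1 - psi lam 0 := by rw [← psi_one_sub, sub_zero]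
    rw [← regret_majority_eq_of_margin_rev (ciidReports_nonneg hn hlam0 hr)
      (ciidReports_nonneg hn hlam0 hmem') hrev]
    refine key m' _ _ h' (fun w => by linarith [hu !w]) (fun w => by linarith [hl !w])
      (by simp only [Bool.not_false, Bool.not_true]; linarith) fun x hx hx' => ?_
    have e := hrev ⟨x, by omega⟩
    rw [show (((⟨x, by omega⟩ : Fin (n + 1)).rev : Fin (n + 1)) : ℕ) = n - x by
      simp [Fin.val_rev]] at e
    change 0 ≤ margin _ ((⟨x, by omega⟩ : Fin (n + 1)) : ℕ)
    rw [e]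
    have := margin_nonpos_of_margin_neg h.prior_nonneg ((psi_pos lam 0).trans_le (hl false)) ha
      ((hu true).trans_lt (psi_lt_one lam 1)) (show n - x ≤ x₀ by omega) hx₀ hneg
    linarith

end QuantalVoting

end

open QuantalVoting in
theorem theorem1 :
    -- optimal robust aggregator
    (∀ n : ℕ, 1 ≤ n →
      (∀ lam : ℝ, 0 ≤ lam → (lam : EReal) ≤ threshold n →
        (∀ f : Aggregator n,
          IsGreatest (regret f '' ciidReports n (psi lam)) (worstRegret n (psi lam) f)) ∧
        IsLeast (Set.range fun f : Aggregator n => worstRegret n (psi lam) f)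
          (worstRegret n (psi lam) (majority n))) ∧
      (n ≤ 2 → threshold n = ⊤)) ∧
    -- a single expert does best under perfect rationality
    (∀ θ : SignalStructure 1, θ.IsCIID → ∀ lam : ℝ, 0 ≤ lam →
      maxUtility (rep θ (psi lam)) ≤ utility (majority 1) (rep θ psiInfty) ∧
      utility (majority 1) (rep θ psiInfty) = maxUtility (rep θ psiInfty)) ∧
    -- bounded rationality advantage
    (∀ n : ℕ, 2 ≤ n → ∃ θ : SignalStructure n, θ.IsCIID ∧ ∃ lam : ℝ, 0 ≤ lam ∧
      maxUtility (rep θ psiInfty) < maxUtility (rep θ (psi lam)) ∧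
      (2 < n →
        maxUtility (rep θ psiInfty) < utility (majority n) (rep θ (psi lam)))) := by
  refine ⟨fun n hn => ⟨fun lam h0 hle => ?_, threshold_eq_top⟩,
    fun θ hθ lam hlam => single_expert_psiInfty_best hθ hlam,
    fun n hn => exists_bounded_rationality_advantage hn⟩
  refine ⟨isGreatest_worstRegret hn h0, ⟨majority n, rfl⟩, ?_⟩
  rintro _ ⟨f, rfl⟩
  exact worstRegret_majority_le hn (mem_thresholdSet_of_le_threshold h0 hle) f
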